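/- **Theorem (Shielded complex source).** Let $\mathbf y\in\mathbb R^3$, $a=|\mathbf y|>0$, and $u\in\mathbb R$ with $|u|>a$ (so $y=(\mathbf y,iu)$ is timelike), and let $\varepsilon>0$. Let $g$ be holomorphic on $\{\tau\in\mathbb C:\operatorname{Im}\tau\neq0\}$, for example the analytic signal $g(\tau)=\frac1{2\pi i}\int\frac{g_0(t')\,dt'}{\tau-t'}$ of a driving signal $g_0$. For $\mathbf x\in\mathbb R^3$ let $\tilde r=\sqrt{(\mathbf x-i\mathbf y)^2}=p-iq$ with $p\ge0$ (so $|q|\le a$), where $(\cdot)^2$ is the bilinear square. Put $\tau=t-iu$ and $$W(\mathbf x,t)=\frac{g(\tau-\tilde r)}{4\pi\tilde r},\qquad W_\varepsilon=\Theta(p-\varepsilon a)\,W,$$ where $\Theta$ is the Heaviside function. Let $E_{\varepsilon a}$ be the oblate spheroid $\frac{\rho^2}{(\varepsilon a)^2+a^2}+\frac{\xi^2}{(\varepsilon a)^2}=1$, where $\xi=\mathbf x\cdot\mathbf y/a$ and $\rho^2=|\mathbf x|^2-\xi^2$. Let $(p,q,\phi)$ be oblate spheroidal coordinates: $a\xi=pq$,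 $a^2\rho^2=(p^2+a^2)(a^2-q^2)$, and $\phi$ is the azimuth about $\mathbf y$, measured in any orthonormal frame of $\mathbf y^\perp$. The volume element is $d\mathbf x=a^{-1}|\tilde r|^2\,dp\,dq\,d\phi$. Write $\alpha=\varepsilon a-ia$; the north and south poles of $E_{\varepsilon a}$ are the points where $\tilde r=\alpha$ and $\tilde r=\alpha^*$. Then: 1. $W_\varepsilon$ is locally integrable on $\mathbb R^3\times\mathbb R$, so $S_\varepsilon=-\square W_\varepsilon$, with $\square=\Delta-\partial_t^2$, is a distribution on $\mathbb R^3\times\mathbb R$. Its support is contained in the world tube $E_{\varepsilon a}\times\mathbb R$. 2. $S_\varepsilon$ is regular in $t$: there are distributions $S_\varepsilon(t)$ on $\mathbb R^3$, $t\in\mathbb R$, such that $t\mapsto\langle S_\varepsilon(t),f\rangle$ is smooth for each test function $f$ on $\mathbb R^3$, and for each test function $F$ on $\mathbb R^3\times\mathbb R$ the function $t\mapsto\langle S_\varepsilon(t),F(\cdot,t)\rangle$ is integrable with $\langle S_\varepsilon,F\rangle=\int_{\mathbb R}\langle S_\varepsilon(t),F(\cdot,t)\rangle\,dt$. 3. For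 each $t$ and each test function $f$ on $\mathbb R^3$, with $\bar f(p,q)=\frac1{2\pi}\int_0^{2\pi}f(p,q,\phi)\,d\phi$ and $2\bar f_{\tilde r}=\partial_p\bar f+i\,\partial_q\bar f$, $$\langle S_\varepsilon(t),f\rangle=\frac{\alpha^*\alpha}{2a}\left[\frac{g(\tau-\tilde r)\,\bar f}{i\,\tilde r}\right]_{\tilde r=\alpha^*}^{\tilde r=\alpha}+\frac{\alpha^*\alpha}{a}\int_{-a}^{a}\frac{dq}{\tilde r}\;g(\tau-\tilde r)\,\bar f_{\tilde r}\,\Big|_{p=\varepsilon a}.$$ Here $\bar f$ is differentiable at $(\varepsilon a,q)$ for $|q|<a$, and the integral converges absolutely. 4. Equivalently, without smearing, $$S_\varepsilon=W\left\{-i\,\delta(\tilde r-\alpha)+i\,\delta(\tilde r-\alpha^*)+\left|\frac{\alpha}{\tilde r}\right|^2\delta(p-\varepsilon a)\,(\partial_p+i\,\partial_q)\right\},$$ applied as a differential operator to $f$ and then integrated over $\mathbb R^3$ (the integral converges absolutely). Here $\delta(\tilde r-\alpha)=\delta(p-\varepsilon a)\,\delta(q-a)$ and $\delta(\tilde r-\alpha^*)=\delta(p-\varepsilon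 a)\,\delta(q+a)$ are taken with respect to the above volume element, with full mass at the end points $q=\pm a$. Thus $S_\varepsilon$ consists of point sources at the two poles, a double layer ($\partial_p$) and a surface flow ($\partial_q$) on $E_{\varepsilon a}$, all modulated by $W$. -/

import Mathlib

open MeasureTheory Set Filter Topology Complex
open scoped Distributions LineDeriv ContDiff ComplexConjugate RealInnerProductSpace

noncomputable section

namespace ShieldedSource

/-- Physical space `ℝ³`. -/
abbrev Space := EuclideanSpace ℝ (Fin 3)

/-- Real spacetime: pairs `(𝐱, t)` of a position and a time. -/
abbrev Spacetime := Space × ℝ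

/-! ### Complex distance, beam, and spheroid -/

/-- The complex distance `r̃ = √((𝐱 - i𝐲)²)` from the complex source point `i𝐲` to `𝐱`, where `𝐳²`
is the bilinear square and the branch of the square root is the principal one, `Re r̃ ≥ 0`. -/
def complexDist (y x : Space) : ℂ :=
  (∑ j, ((x j : ℂ) - I * (y j : ℂ)) ^ 2) ^ (1 / 2 : ℂ)

/-- The beam `W = g(τ - r̃) / (4π r̃)` with `τ = t - iu`. -/
def beam (g : ℂ → ℂ) (y : Space) (u : ℝ) (X : Spacetime) : ℂ :=
  g ((X.2 : ℂ) - I * (u : ℂ) - complexDist y X.1) / (4 * (Real.pi : ℂ) * complexDist y X.1)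

open Classical in
/-- The shielded beam `W_ε = Θ(p - εa) W`, where `p = Re r̃` and `a = |𝐲|`. -/
def shieldedBeam (g : ℂ → ℂ) (y : Space) (u ε : ℝ) (X : Spacetime) : ℂ :=
  if ε * ‖y‖ < (complexDist y X.1).re then beam g y u X else 0

/-- The oblate spheroid `E_p`: the points with `ρ² / (p² + a²) + ξ² / p² = 1`, where `a = |𝐲|`,
`ξ = 𝐱 · 𝐲 / a` and `ρ² = |𝐱|² - ξ²`. -/
def spheroid (y : Space) (p : ℝ) : Set Space :=
  {x | (‖x‖ ^ 2 - (⟪x, y⟫ / ‖y‖) ^ 2) / (p ^ 2 + ‖y‖ ^ 2) + (⟪x, y⟫ / ‖y‖) ^ 2 / p ^ 2 = 1}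

/-- The world tube swept out by a subset of space at rest. -/
def worldTube (A : Set Space) : Set Spacetime := {X | X.1 ∈ A}

/-! ### Distributions on spacetime -/

/-- The distribution `φ ↦ ∫ φ h` of a locally integrable function `h` on spacetime. -/
def toDistribution (h : Spacetime → ℂ) : 𝓓'((⊤ : TopologicalSpace.Opens Spacetime), ℂ) :=
  TestFunction.integralAgainstBilinCLM
    (ContinuousLinearMap.lsmul ℝ ℝ : ℝ →L[ℝ] ℂ →L[ℝ] ℂ) volume h

/-- The `j`-th spatial coordinate direction of spacetime. -/
def spaceDir (j : Fin 3) : Spacetime := (EuclideanSpace.single j 1, 0)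

/-- The time direction of spacetime. -/
def timeDir : Spacetime := (0, 1)

/-- The distributional wave operator `□ = Δ - ∂ₜ²`. -/
def waveOp (S : 𝓓'((⊤ : TopologicalSpace.Opens Spacetime), ℂ)) :
    𝓓'((⊤ : TopologicalSpace.Opens Spacetime), ℂ) :=
  (∑ j : Fin 3, ∂_{spaceDir j} (∂_{spaceDir j} S)) - ∂_{timeDir} (∂_{timeDir} S)

/-- The shielded source `S_ε = -□ W_ε`. -/
def shieldedSource (g : ℂ → ℂ) (y : Space) (u ε : ℝ) :
    𝓓'((⊤ : TopologicalSpace.Opens Spacetime), ℂ) :=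
  -waveOp (toDistribution (shieldedBeam g y u ε))

/-- The spatial test function `F(·, t)` at a fixed time. -/
def timeSlice (F : 𝓓((⊤ : TopologicalSpace.Opens Spacetime), ℝ)) (t : ℝ) :
    𝓓((⊤ : TopologicalSpace.Opens Space), ℝ) where
  toFun x := F (x, t)
  contDiff' := F.contDiff.comp (contDiff_id.prodMk contDiff_const)
  hasCompactSupport' := F.hasCompactSupport.comp_isClosedEmbedding
    (Topology.IsClosedEmbedding.of_continuous_injective_isClosedMap (by fun_prop)
      (fun _ _ h => congrArg Prod.fst h) (by
        intro A hA
        have : (fun x : Space => ((x, t) : Spacetime)) '' A = A ×ˢ {t} := by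
          ext ⟨x, s⟩; simp [eq_comm]
        rw [this]
        exact hA.prod isClosed_singleton))
  tsupport_subset' := fun _ _ => trivial

/-- `S` is regular in `t`, with the spatial distributions `T t` as its values at fixed times:
`t ↦ ⟨T t, f⟩` is smooth for each spatial test function `f`, and `⟨S, F⟩ = ∫ ⟨T t, F(·, t)⟩ dt` for
each test function `F` on spacetime. -/
def IsRegularInTime (S : 𝓓'((⊤ : TopologicalSpace.Opens Spacetime), ℂ))
    (T : ℝ → 𝓓'((⊤ : TopologicalSpace.Opens Space), ℂ)) : Prop :=
  (∀ f, ContDiff ℝ ∞ (fun t => T t f)) ∧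
    ∀ F, Integrable (fun t => T t (timeSlice F t)) ∧ S F = ∫ t, T t (timeSlice F t)

/-! ### Oblate spheroidal coordinates

In these coordinates `r̃ = p - iq`, with `p ≥ 0` and `-a ≤ q ≤ a`, `φ` is the azimuth about the
axis `𝐲`, and the volume element is `d𝐱 = a⁻¹ |r̃|² dp dq dφ`. -/

/-- The point with oblate spheroidal coordinates `(p, q, φ)`: it has `a ξ = p q`,
`a² ρ² = (p² + a²)(a² - q²)` and azimuth `φ` in the frame `e₁, e₂` of the plane `𝐲^⊥`. -/
def osPoint (y e₁ e₂ : Space) (p q φ : ℝ) : Space :=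
  (p * q / ‖y‖) • (‖y‖⁻¹ • y) +
    (Real.sqrt ((p ^ 2 + ‖y‖ ^ 2) * (‖y‖ ^ 2 - q ^ 2)) / ‖y‖) •
      (Real.cos φ • e₁ + Real.sin φ • e₂)

/-- The mean of `f` over the azimuth. -/
def azMean (y e₁ e₂ : Space) (f : Space → ℝ) (p q : ℝ) : ℝ :=
  (1 / (2 * Real.pi)) * ∫ φ in (0 : ℝ)..(2 * Real.pi), f (osPoint y e₁ e₂ p q φ)

/-- The operator `∂_p + i ∂_q` on a real function of `(p, q)`. -/
def dPQ (h : ℝ → ℝ → ℝ) (p q : ℝ) : ℂ :=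
  (deriv (fun p' => h p' q) p : ℂ) + I * (deriv (fun q' => h p q') q : ℂ)

/-- The range of the coordinates `(q, φ)` on a spheroid. -/
def osRange (a : ℝ) : Set (ℝ × ℝ) := Ioo (-a) a ×ˢ Ioo 0 (2 * Real.pi)

/-- `|r̃|² h / a` on the surface `p = c`: the density, with respect to `dq dφ`, of `h δ(p - c)`
integrated over space. -/
def shellDensity (a c : ℝ) (h : ℝ → ℝ → ℝ → ℂ) (v : ℝ × ℝ) : ℂ :=
  ((‖(c : ℂ) - I * (v.1 : ℂ)‖ ^ 2 / a : ℝ) : ℂ) * h c v.1 v.2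

/-- `∫ δ(p - c) h d𝐱` for a function `h` of the oblate spheroidal coordinates. -/
def shellDelta (a c : ℝ) (h : ℝ → ℝ → ℝ → ℂ) : ℂ :=
  ∫ v in osRange a, shellDensity a c h v

/-- `∫ δ(p - c) δ(q - b) h d𝐱` for a function `h` of the oblate spheroidal coordinates. -/
def poleDelta (a c b : ℝ) (h : ℝ → ℝ → ℝ → ℂ) : ℂ :=
  ∫ φ in (0 : ℝ)..(2 * Real.pi), shellDensity a c h (b, φ)

/-- The smeared expression for the source at time `t`, with `α = εa - ia` and `τ = t - iu`:
`(α* α / 2a) [g f̀ / (i r̃)]` between `r̃ = α*` and `r̃ = α`, plus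
`(α* α / a) ∫ (dq / r̃) g f̀_r̃` over `-a ≤ q ≤ a` at `p = εa`, where `g = g(τ - r̃)`,
`f̀` is the azimuthal mean of `f` and `2 f̀_r̃ = ∂_p f̀ + i ∂_q f̀`. -/
def smearedFormula (g : ℂ → ℂ) (y : Space) (u ε : ℝ) (e₁ e₂ : Space) (t : ℝ)
    (f : Space → ℝ) : ℂ :=
  let a : ℝ := ‖y‖
  let τ : ℂ := (t : ℂ) - I * (u : ℂ)
  let α : ℂ := ((ε * a : ℝ) : ℂ) - I * (a : ℂ)
  (conj α * α / (2 * (a : ℂ))) *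
      (g (τ - α) * (azMean y e₁ e₂ f (ε * a) a : ℂ) / (I * α) -
        g (τ - conj α) * (azMean y e₁ e₂ f (ε * a) (-a) : ℂ) / (I * conj α)) +
    (conj α * α / (a : ℂ)) *
      ∫ q in (-a)..a, 1 / (((ε * a : ℝ) : ℂ) - I * (q : ℂ)) *
        g (τ - (((ε * a : ℝ) : ℂ) - I * (q : ℂ))) *
        ((1 / 2) * dPQ (azMean y e₁ e₂ f) (ε * a) q)

/-- `W |α / r̃|² (∂_p + i ∂_q) f` at time `t`, as a function of `(p, q, φ)`; here `α = εa - ia`. -/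
def layerFlow (g : ℂ → ℂ) (y : Space) (u ε : ℝ) (e₁ e₂ : Space) (t : ℝ)
    (f : Space → ℝ) (p q φ : ℝ) : ℂ :=
  beam g y u (osPoint y e₁ e₂ p q φ, t) *
    ((‖(((ε * ‖y‖ : ℝ) : ℂ) - I * (‖y‖ : ℂ)) / ((p : ℂ) - I * (q : ℂ))‖ ^ 2 : ℝ) : ℂ) *
    dPQ (fun p' q' => f (osPoint y e₁ e₂ p' q' φ)) p q

/-- The expression
`W { i δ(r̃ - α*) - i δ(r̃ - α) + |α / r̃|² δ(p - εa) (∂_p + i ∂_q) }` at time `t`, applied to `f`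
as a differential operator and integrated over space. -/
def localFormula (g : ℂ → ℂ) (y : Space) (u ε : ℝ) (e₁ e₂ : Space) (t : ℝ)
    (f : Space → ℝ) : ℂ :=
  let a : ℝ := ‖y‖
  let Wf : ℝ → ℝ → ℝ → ℂ := fun p q φ =>
    beam g y u (osPoint y e₁ e₂ p q φ, t) * (f (osPoint y e₁ e₂ p q φ) : ℂ)
  I * poleDelta a (ε * a) (-a) Wf - I * poleDelta a (ε * a) a Wf +
    shellDelta a (ε * a) (layerFlow g y u ε e₁ e₂ t f)

end ShieldedSource

end

/-! # The source of the shielded complex beam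

Off the branch disk `p = 0` the complex distance is smooth with `∇r̃ = (𝐱 - i𝐲) / r̃`, so
`∇r̃ · ∇r̃ = 1` and `Δr̃ = 2 / r̃`, as for the real distance. It takes values in the half strip
`0 < Re z`, `|Im z| ≤ a < |u|`, where `τ - r̃` avoids the real axis. At each time the beam is thus
`W = h(r̃)` with the holomorphic profile `h(z) = g(τ - z) / (4π z)`; it is smooth for `p > 0`, and
`h'' + 2 h' / z = ∂ₜ² h` gives `ΔW = ∂ₜ² W` there.

Time derivatives of `W_ε` fall on the signal `g`, which stays holomorphic, and the cutoff does not
move. Hence `S_ε` has the time slices `S_ε(t) = -(Δ W_ε(·, t) - Θ ∂ₜ² W)`, and their pairings with a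
fixed test function are smooth in `t` (`isRegularInTime_sourceAt`).

The slices are computed by Green's identity. Replacing `Θ(p - εa)` by smooth cutoffs `χ(p)`, all
derivatives are classical (`green_cutoff`), and only the flux through the transition region remains.
In oblate spheroidal coordinates (`integral_osPoint`) the gradient of `p` is
`(p² + a²) / |r̃|² ∂_p`, and the factor `|r̃|²` cancels in the volume element, so that in the limit
(`sourceAt_eq_integral_boundaryDensity`)
`⟨S_ε(t), f⟩ = ((p² + a²) / a) ∫ (W ∂_p f - f ∂_p W) dq dφ` at `p = εa`.
This involves `f` and its derivatives only on the spheroid, whence the bound on the support.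

As `W` is a holomorphic function of `r̃ = p - iq`, the Cauchy–Riemann equations give
`∂_p W = i ∂_q W`. Integrating `-i f ∂_q W` by parts in `q` moves the derivative to `f`, which
yields `W (∂_p + i ∂_q) f`, and leaves the boundary values at `q = ± a`, that is at the two poles
(`integral_boundaryDensity_eq`). The coordinate field `∂_q` has an inverse square root singularity
at the poles, which is integrable. The two formulas of the theorem are this identity in two
notations. -/

noncomputable section

namespace ShieldedSource

/-! ### The complex distance -/

theorem sum_sq_eq (y x : Space) :
    ∑ j, ((x j : ℂ) - I * (y j : ℂ)) ^ 2 =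
      ((‖x‖ ^ 2 - ‖y‖ ^ 2 : ℝ) : ℂ) - 2 * I * (⟪x, y⟫ : ℝ) := by
  have hx := EuclideanSpace.real_norm_sq_eq x
  have hy := EuclideanSpace.real_norm_sq_eq y
  have hxy : (⟪x, y⟫ : ℝ) = ∑ i, x i * y i := by
    simp [PiLp.inner_apply, mul_comm]
  rw [hx, hy, hxy]
  simp only [Fin.sum_univ_three]
  push_cast
  linear_combination ((y 0 : ℂ) ^ 2 + (y 1 : ℂ) ^ 2 + (y 2 : ℂ) ^ 2) * I_sq

theorem complexDist_sq (y x : Space) :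
    complexDist y x ^ 2 = ((‖x‖ ^ 2 - ‖y‖ ^ 2 : ℝ) : ℂ) - 2 * I * (⟪x, y⟫ : ℝ) := by
  have := cpow_ofNat_inv_pow (∑ j, ((x j : ℂ) - I * (y j : ℂ)) ^ 2) 2
  rw [complexDist, one_div, this, sum_sq_eq]

/-- The closed form of `p = Re r̃`, which shows its continuity across the branch disk, where `r̃`
itself jumps. -/
theorem complexDist_re (y x : Space) :
    (complexDist y x).re = Real.sqrt
      ((‖((‖x‖ ^ 2 - ‖y‖ ^ 2 : ℝ) : ℂ) - 2 * I * (⟪x, y⟫ : ℝ)‖ + (‖x‖ ^ 2 - ‖y‖ ^ 2)) / 2) := by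
  rw [complexDist, one_div, cpow_inv_two_re, sum_sq_eq]
  congr 3
  simp [-ofReal_pow]

theorem continuous_complexDist_re (y : Space) : Continuous fun x => (complexDist y x).re := by
  simp only [complexDist_re]
  fun_prop

/-- The real part of the defining relation `r̃² = (𝐱 - i𝐲)²`: `p² - q² = |𝐱|² - a²`. -/
theorem re_sq_sub_im_sq (y x : Space) :
    (complexDist y x).re ^ 2 - (complexDist y x).im ^ 2 = ‖x‖ ^ 2 - ‖y‖ ^ 2 := by
  have := congrArg re (complexDist_sq y x)
  simpa [sq] using this

/-- The imaginary part of the defining relation `r̃² = (𝐱 - i𝐲)²`: `p q = 𝐱 · 𝐲`. -/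
theorem re_mul_im (y x : Space) :
    (complexDist y x).re * (complexDist y x).im = -⟪x, y⟫ := by
  have := congrArg im (complexDist_sq y x)
  simp [sq] at this
  linarith

/-- `|q| ≤ a`, by Cauchy–Schwarz: `(p² + a²) (q² - a²) = (𝐱 · 𝐲)² - |𝐱|² a² ≤ 0`. -/
theorem abs_complexDist_im_le {y : Space} (hy : y ≠ 0) (x : Space) :
    |(complexDist y x).im| ≤ ‖y‖ := by
  have h1 := re_sq_sub_im_sq y x
  have h2 := re_mul_im y x
  have h3 : ⟪x, y⟫ ^ 2 ≤ ‖x‖ ^ 2 * ‖y‖ ^ 2 := by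
    rw [← mul_pow, ← sq_abs]
    exact pow_le_pow_left₀ (abs_nonneg _) (abs_real_inner_le_norm x y) 2
  have hy' : 0 < ‖y‖ := norm_pos_iff.2 hy
  set p := (complexDist y x).re
  set q := (complexDist y x).im
  rw [show (⟪x, y⟫ : ℝ) = -(p * q) by linarith, show ‖x‖ ^ 2 = p ^ 2 - q ^ 2 + ‖y‖ ^ 2 by linarith]
    at h3
  refine abs_le_of_sq_le_sq ?_ hy'.le
  by_contra! hlt
  nlinarith [mul_pos (sub_pos.2 hlt) (show 0 < p ^ 2 + ‖y‖ ^ 2 by positivity)]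

/-- The square root with positive real part is the complex distance. -/
theorem complexDist_eq_of_sq {y x : Space} {w : ℂ} (hw : 0 < w.re)
    (h1 : w.re ^ 2 - w.im ^ 2 = ‖x‖ ^ 2 - ‖y‖ ^ 2) (h2 : w.re * w.im = -⟪x, y⟫) :
    complexDist y x = w := by
  have : ∑ j, ((x j : ℂ) - I * (y j : ℂ)) ^ 2 = w ^ 2 := by
    rw [sum_sq_eq]
    apply Complex.ext
    · simp [sq] at h1 ⊢; linarith
    · simp [sq]; linarith
  rw [complexDist, one_div, this, sq_cpow_two_inv hw]

/-- The linear form `𝐯 ↦ (𝐱 - i𝐲) · 𝐯`. -/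
def sepForm (y x : Space) : Space →L[ℝ] ℂ :=
  ofRealCLM ∘L innerSL ℝ x - I • (ofRealCLM ∘L innerSL ℝ y)

@[simp]
theorem sepForm_apply (y x v : Space) :
    sepForm y x v = (⟪x, v⟫ : ℝ) - I * (⟪y, v⟫ : ℝ) := by
  simp [sepForm]

theorem continuous_sepForm (y : Space) : Continuous (sepForm y) := by
  unfold sepForm
  fun_prop

/-- Off the branch disk `p = 0` the gradient of `r̃` is `(𝐱 - i𝐲) / r̃`. -/
theorem hasFDerivAt_complexDist {y x : Space} (hx : 0 < (complexDist y x).re) :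
    HasFDerivAt (complexDist y) ((complexDist y x)⁻¹ • sepForm y x) x := by
  set R := complexDist y x with hR
  have hR0 : R ≠ 0 := fun h => by simp [h] at hx
  have key : ∀ x', ∑ j, ((x' j : ℂ) - I * (y j : ℂ)) ^ 2 =
      ((⟪x', x'⟫ : ℝ) : ℂ) - ((‖y‖ ^ 2 : ℝ) : ℂ) - 2 * I * (⟪x', y⟫ : ℝ) := fun x' => by
    rw [sum_sq_eq, real_inner_self_eq_norm_sq]; push_cast; ring
  have hfun : complexDist y = fun x' =>
      (((⟪x', x'⟫ : ℝ) : ℂ) - ((‖y‖ ^ 2 : ℝ) : ℂ) - 2 * I * (⟪x', y⟫ : ℝ)) ^ (2⁻¹ : ℂ) := by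
    funext x'; rw [complexDist, one_div, key]
  have hsq : ((⟪x, x⟫ : ℝ) : ℂ) - ((‖y‖ ^ 2 : ℝ) : ℂ) - 2 * I * (⟪x, y⟫ : ℝ) = R ^ 2 := by
    rw [hR, complexDist_sq, real_inner_self_eq_norm_sq]; push_cast; ring
  have hin : HasFDerivAt (fun x' : Space =>
      ((⟪x', x'⟫ : ℝ) : ℂ) - ((‖y‖ ^ 2 : ℝ) : ℂ) - 2 * I * (⟪x', y⟫ : ℝ))
      ((2 : ℂ) • sepForm y x) x := by
    have e1 : HasFDerivAt (fun x' : Space => ((⟪x', x'⟫ : ℝ) : ℂ)) _ x :=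
      ofRealCLM.hasFDerivAt.comp x ((hasFDerivAt_id x).inner ℝ (hasFDerivAt_id x))
    have e2 : HasFDerivAt (fun x' : Space => ((⟪x', y⟫ : ℝ) : ℂ)) _ x :=
      ofRealCLM.hasFDerivAt.comp x ((hasFDerivAt_id x).inner ℝ (hasFDerivAt_const y x))
    refine ((e1.sub_const ((‖y‖ ^ 2 : ℝ) : ℂ)).sub (e2.const_mul (2 * I))).congr_fderiv ?_
    ext v
    simp [real_inner_comm]
    ring
  -- `Re R > 0` keeps `R²` off the branch cut of the square root
  have hslit : R ^ 2 ∈ slitPlane := by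
    rw [mem_slitPlane_iff]
    by_cases him : R.im = 0
    · left; simp [sq, him]; positivity
    · right; simp [sq]
      rw [show R.re * R.im + R.im * R.re = 2 * (R.re * R.im) by ring]
      exact mul_ne_zero two_ne_zero (mul_ne_zero hx.ne' him)
  have := HasDerivAt.comp_hasFDerivAt (𝕜 := ℝ) (𝕜' := ℂ) x
    (h₂ := fun z : ℂ => z ^ (2⁻¹ : ℂ)) (h₂' := R⁻¹ / 2) (f := fun x' : Space =>
      ((⟪x', x'⟫ : ℝ) : ℂ) - ((‖y‖ ^ 2 : ℝ) : ℂ) - 2 * I * (⟪x', y⟫ : ℝ)) ?_ hin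
  · rw [hfun]
    refine this.congr_fderiv ?_
    ext v
    simp only [_root_.smul_apply, smul_eq_mul]
    ring
  · have hd := (hasDerivAt_id (R ^ 2)).cpow_const (c := (2⁻¹ : ℂ)) (by simpa using hslit)
    simp only [id_eq] at hd
    rw [hsq]
    refine hd.congr_deriv ?_
    rw [cpow_sub _ _ (pow_ne_zero 2 hR0), cpow_one,
      sq_cpow_two_inv hx]
    field_simp

theorem continuousAt_complexDist {y x : Space} (hx : 0 < (complexDist y x).re) :
    ContinuousAt (complexDist y) x :=
  (hasFDerivAt_complexDist hx).continuousAt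

/-- The half strip in which `r̃` takes its values off the branch disk; there `τ - r̃` is not real,
and `r̃ ≠ 0`. -/
def halfStrip (u : ℝ) : Set ℂ := {z | 0 < z.re ∧ |z.im| < |u|}

theorem complexDist_mem_halfStrip {y : Space} (hy : y ≠ 0) {u : ℝ} (hu : ‖y‖ < |u|) {x : Space}
    (hx : 0 < (complexDist y x).re) : complexDist y x ∈ halfStrip u :=
  ⟨hx, (abs_complexDist_im_le hy x).trans_lt hu⟩

theorem ne_zero_of_mem_halfStrip {u : ℝ} {z : ℂ} (hz : z ∈ halfStrip u) : z ≠ 0 := by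
  rintro rfl; exact absurd hz.1 (by simp)

theorem sub_im_ne_zero {u : ℝ} {z : ℂ} (hz : z ∈ halfStrip u) (t : ℝ) :
    ((t : ℂ) - I * (u : ℂ) - z).im ≠ 0 := by
  intro h
  have : z.im = -u := by simp at h; linarith
  have h2 := hz.2
  rw [this, abs_neg] at h2
  exact lt_irrefl _ h2

/-- The radial profile `h(z) = g(τ - z) / (4π z)` of the beam at time `t`: `W = h(r̃)`. -/
def profile (g : ℂ → ℂ) (u t : ℝ) (z : ℂ) : ℂ :=
  g ((t : ℂ) - I * (u : ℂ) - z) / (4 * (Real.pi : ℂ) * z)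

theorem beam_eq (g : ℂ → ℂ) (y : Space) (u t : ℝ) (x : Space) :
    beam g y u (x, t) = profile g u t (complexDist y x) := rfl

theorem isOpen_im_ne_zero : IsOpen {τ : ℂ | τ.im ≠ 0} :=
  isOpen_ne_fun continuous_im continuous_const

theorem hasDerivAt_profile {g : ℂ → ℂ} (hg : DifferentiableOn ℂ g {τ | τ.im ≠ 0}) {u : ℝ} (t : ℝ)
    {z : ℂ} (hz : z ∈ halfStrip u) :
    HasDerivAt (profile g u t) (-profile (deriv g) u t z - profile g u t z / z) z := by
  have hz0 := ne_zero_of_mem_halfStrip hz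
  have hπ : (Real.pi : ℂ) ≠ 0 := by exact_mod_cast Real.pi_ne_zero
  have h1 : HasDerivAt g (deriv g ((t : ℂ) - I * (u : ℂ) - z)) ((t : ℂ) - I * (u : ℂ) - z) :=
    (hg.differentiableAt (isOpen_im_ne_zero.mem_nhds (sub_im_ne_zero hz t))).hasDerivAt
  have h2 := (h1.comp z ((hasDerivAt_id z).const_sub ((t : ℂ) - I * (u : ℂ)))).div
    ((hasDerivAt_id z).const_mul (4 * (Real.pi : ℂ)))
    (mul_ne_zero (mul_ne_zero (by norm_num) hπ) hz0)
  refine h2.congr_deriv ?_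
  simp only [profile, Function.comp, id]
  field_simp

theorem differentiableOn_deriv {g : ℂ → ℂ} (hg : DifferentiableOn ℂ g {τ | τ.im ≠ 0}) :
    DifferentiableOn ℂ (deriv g) {τ | τ.im ≠ 0} :=
  hg.deriv isOpen_im_ne_zero

/-- The time derivative of the profile is the profile of the differentiated signal. -/
theorem hasDerivAt_profile_time {g : ℂ → ℂ} (hg : DifferentiableOn ℂ g {τ | τ.im ≠ 0}) {u : ℝ}
    (t : ℝ) {z : ℂ} (hz : z ∈ halfStrip u) :
    HasDerivAt (fun s : ℝ => profile g u s z) (profile (deriv g) u t z) t := by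
  have h1 : HasDerivAt g (deriv g ((t : ℂ) - I * (u : ℂ) - z)) ((t : ℂ) - I * (u : ℂ) - z) :=
    (hg.differentiableAt (isOpen_im_ne_zero.mem_nhds (sub_im_ne_zero hz t))).hasDerivAt
  have h0 : HasDerivAt (fun s : ℝ => (s : ℂ) - I * (u : ℂ) - z) 1 t := by
    simpa using ((hasDerivAt_id t).ofReal_comp.sub_const (I * (u : ℂ))).sub_const z
  have h2 := (h1.comp t h0).div_const (4 * (Real.pi : ℂ) * z)
  simpa [profile, Function.comp_def] using h2

/-- The profile is jointly continuous in the time and the complex distance. -/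
theorem continuousOn_profile {g : ℂ → ℂ} (hg : DifferentiableOn ℂ g {τ | τ.im ≠ 0}) (u : ℝ) :
    ContinuousOn (fun v : ℂ × ℝ => profile g u v.2 v.1) {v | v.1 ∈ halfStrip u} := by
  have hπ : (Real.pi : ℂ) ≠ 0 := by exact_mod_cast Real.pi_ne_zero
  refine ContinuousOn.div (hg.continuousOn.comp (by fun_prop) ?_) (by fun_prop) ?_
  · exact fun v hv => sub_im_ne_zero hv v.2
  · exact fun v hv =>
      mul_ne_zero (mul_ne_zero (by norm_num) hπ) (ne_zero_of_mem_halfStrip hv)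

/-! ### Local integrability and regularity in time -/

/-- A function continuous on a closed set, cut off to a measurable part of that set, is locally
integrable. -/
theorem locallyIntegrable_indicator {X : Type*} [TopologicalSpace X] [MeasurableSpace X]
    [OpensMeasurableSpace X] [WeaklyLocallyCompactSpace X] [T2Space X] {μ : Measure X}
    [IsFiniteMeasureOnCompacts μ] {A B : Set X} (hA : IsClosed A) (hB : MeasurableSet B)
    (hBA : B ⊆ A) {F : X → ℂ} (hF : ContinuousOn F A) : LocallyIntegrable (B.indicator F) μ := by
  rw [locallyIntegrable_iff]
  intro K hK
  rw [IntegrableOn, integrable_indicator_iff hB, IntegrableOn, Measure.restrict_restrict hB]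
  have h : IntegrableOn F (A ∩ K) μ :=
    (hF.mono inter_subset_left).integrableOn_compact' (hK.inter_left hA)
      (hA.measurableSet.inter hK.measurableSet)
  exact h.mono_set (inter_subset_inter_left _ hBA)

section

variable {y : Space} {u ε : ℝ} {g : ℂ → ℂ}

theorem shieldedBeam_eq_indicator (g : ℂ → ℂ) (y : Space) (u ε : ℝ) :
    shieldedBeam g y u ε =
      {X : Spacetime | ε * ‖y‖ < (complexDist y X.1).re}.indicator (beam g y u) := by
  classical
  funext X
  simp only [shieldedBeam, indicator_apply, mem_ofPred_eq]

theorem continuousOn_beam (hy : y ≠ 0) (hu : ‖y‖ < |u|)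
    (hg : DifferentiableOn ℂ g {τ | τ.im ≠ 0}) :
    ContinuousOn (beam g y u) {X | 0 < (complexDist y X.1).re} := by
  have : beam g y u = (fun v : ℂ × ℝ => profile g u v.2 v.1) ∘
      fun X : Spacetime => (complexDist y X.1, X.2) := by
    funext X; exact beam_eq g y u X.2 X.1
  rw [this]
  refine (continuousOn_profile hg u).comp ?_ fun X hX => complexDist_mem_halfStrip hy hu hX
  exact ContinuousOn.prodMk (fun X hX =>
    ((continuousAt_complexDist hX).comp continuousAt_fst).continuousWithinAt) (by fun_prop)

theorem locallyIntegrable_shieldedBeam (hy : y ≠ 0) (hu : ‖y‖ < |u|) (hε : 0 < ε)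
    (hg : DifferentiableOn ℂ g {τ | τ.im ≠ 0}) : LocallyIntegrable (shieldedBeam g y u ε) := by
  have hc : 0 < ε * ‖y‖ := mul_pos hε (norm_pos_iff.2 hy)
  have hp : Continuous fun X : Spacetime => (complexDist y X.1).re :=
    (continuous_complexDist_re y).comp continuous_fst
  rw [shieldedBeam_eq_indicator]
  exact locallyIntegrable_indicator (isClosed_le continuous_const hp)
    (isOpen_lt continuous_const hp).measurableSet
    (fun X hX => show ε * ‖y‖ ≤ (complexDist y X.1).re from le_of_lt hX)
    ((continuousOn_beam hy hu hg).mono fun X hX => hc.trans_le hX)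

theorem locallyIntegrable_shieldedBeam_slice (hy : y ≠ 0) (hu : ‖y‖ < |u|) (hε : 0 < ε)
    (hg : DifferentiableOn ℂ g {τ | τ.im ≠ 0}) (t : ℝ) :
    LocallyIntegrable fun x => shieldedBeam g y u ε (x, t) := by
  have hc : 0 < ε * ‖y‖ := mul_pos hε (norm_pos_iff.2 hy)
  have hp := continuous_complexDist_re y
  rw [shieldedBeam_eq_indicator]
  change LocallyIntegrable
    ({x : Space | ε * ‖y‖ < (complexDist y x).re}.indicator fun x => beam g y u (x, t))
  refine locallyIntegrable_indicator (isClosed_le continuous_const hp)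
    (isOpen_lt continuous_const hp).measurableSet
    (fun x hx => show ε * ‖y‖ ≤ (complexDist y x).re from le_of_lt hx)
    ?_
  exact (continuousOn_beam hy hu hg).comp (by fun_prop) fun x hx => hc.trans_le hx

theorem hasDerivAt_shieldedBeam (hy : y ≠ 0) (hu : ‖y‖ < |u|) (hε : 0 < ε)
    (hg : DifferentiableOn ℂ g {τ | τ.im ≠ 0}) (x : Space) (t : ℝ) :
    HasDerivAt (fun s => shieldedBeam g y u ε (x, s)) (shieldedBeam (deriv g) y u ε (x, t)) t := by
  have hc : 0 < ε * ‖y‖ := mul_pos hε (norm_pos_iff.2 hy)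
  by_cases h : ε * ‖y‖ < (complexDist y x).re
  · simp only [shieldedBeam, h, if_true]
    exact hasDerivAt_profile_time hg t (complexDist_mem_halfStrip hy hu (hc.trans h))
  · simp only [shieldedBeam, h, if_false]
    exact hasDerivAt_const t 0

/-- The distribution on space of a locally integrable function. -/
def spaceDistribution (h : Space → ℂ) : 𝓓'((⊤ : TopologicalSpace.Opens Space), ℂ) :=
  TestFunction.integralAgainstBilinCLM
    (ContinuousLinearMap.lsmul ℝ ℝ : ℝ →L[ℝ] ℂ →L[ℝ] ℂ) volume h

/-- The source at time `t`: minus the distributional Laplacian of `W_ε(·, t)` plus `Θ ∂ₜ² W`, the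
latter being the shielded beam of the signal `g''`. -/
def sourceAt (g : ℂ → ℂ) (y : Space) (u ε t : ℝ) : 𝓓'((⊤ : TopologicalSpace.Opens Space), ℂ) :=
  -((∑ j : Fin 3, ∂_{(EuclideanSpace.single j (1 : ℝ) : Space)}
      (∂_{(EuclideanSpace.single j (1 : ℝ) : Space)}
        (spaceDistribution fun x => shieldedBeam g y u ε (x, t)))) -
    spaceDistribution fun x => shieldedBeam (deriv (deriv g)) y u ε (x, t))

/-- The spatial Laplacian of a test function on space. -/
def laplace (f : 𝓓((⊤ : TopologicalSpace.Opens Space), ℝ)) :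
    𝓓((⊤ : TopologicalSpace.Opens Space), ℝ) :=
  ∑ j : Fin 3, ∂_{(EuclideanSpace.single j (1 : ℝ) : Space)}
    (∂_{(EuclideanSpace.single j (1 : ℝ) : Space)} f)

theorem spaceDistribution_apply {h : Space → ℂ} (hh : LocallyIntegrable h)
    (f : 𝓓((⊤ : TopologicalSpace.Opens Space), ℝ)) :
    spaceDistribution h f = ∫ x, f x • h x := by
  refine (TestFunction.integralAgainstBilinCLM_eq_integral ?_).trans ?_
  · exact hh.locallyIntegrableOn _
  · simp

theorem toDistribution_apply {h : Spacetime → ℂ} (hh : LocallyIntegrable h)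
    (F : 𝓓((⊤ : TopologicalSpace.Opens Spacetime), ℝ)) :
    toDistribution h F = ∫ X, F X • h X := by
  refine (TestFunction.integralAgainstBilinCLM_eq_integral ?_).trans ?_
  · exact hh.locallyIntegrableOn _
  · simp

theorem integrable_smul_testFunction {E : Type*} [NormedAddCommGroup E] [NormedSpace ℝ E]
    [MeasurableSpace E] [OpensMeasurableSpace E] {μ : Measure E} {h : E → ℂ}
    (hh : LocallyIntegrable h μ) (f : 𝓓((⊤ : TopologicalSpace.Opens E), ℝ)) :
    Integrable (fun x => f x • h x) μ :=
  TestFunction.integrable_bilin (ContinuousLinearMap.lsmul ℝ ℝ : ℝ →L[ℝ] ℂ →L[ℝ] ℂ)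
    (hh.locallyIntegrableOn _) f

theorem sourceAt_apply (hy : y ≠ 0) (hu : ‖y‖ < |u|) (hε : 0 < ε)
    (hg : DifferentiableOn ℂ g {τ | τ.im ≠ 0}) (t : ℝ)
    (f : 𝓓((⊤ : TopologicalSpace.Opens Space), ℝ)) :
    sourceAt g y u ε t f = (∫ x, f x • shieldedBeam (deriv (deriv g)) y u ε (x, t)) -
      ∫ x, laplace f x • shieldedBeam g y u ε (x, t) := by
  have h1 := locallyIntegrable_shieldedBeam_slice hy hu hε hg t
  have h2 := locallyIntegrable_shieldedBeam_slice hy hu hε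
    (differentiableOn_deriv (differentiableOn_deriv hg)) t
  rw [← spaceDistribution_apply h1, ← spaceDistribution_apply h2]
  simp [sourceAt, laplace, Fin.sum_univ_three]

/-- Differentiation under the integral sign: `d/dt ∫ k W_ε` is the same integral for `g'`. -/
theorem hasDerivAt_integral_shieldedBeam (hy : y ≠ 0) (hu : ‖y‖ < |u|) (hε : 0 < ε)
    (hg : DifferentiableOn ℂ g {τ | τ.im ≠ 0}) (k : 𝓓((⊤ : TopologicalSpace.Opens Space), ℝ))
    (t : ℝ) :
    HasDerivAt (fun s => ∫ x, k x • shieldedBeam g y u ε (x, s))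
      (∫ x, k x • shieldedBeam (deriv g) y u ε (x, t)) t := by
  have hc : 0 < ε * ‖y‖ := mul_pos hε (norm_pos_iff.2 hy)
  have hg' := differentiableOn_deriv hg
  have hK : IsCompact ((tsupport k ∩ {x : Space | ε * ‖y‖ ≤ (complexDist y x).re}) ×ˢ
      Metric.closedBall t 1) :=
    (k.hasCompactSupport.isCompact.inter_right
      (isClosed_le continuous_const (continuous_complexDist_re y))).prod
      (isCompact_closedBall t 1)
  obtain ⟨C, hC⟩ := hK.exists_bound_of_continuousOn ((continuousOn_beam hy hu hg').mono
    fun X hX => hc.trans_le hX.1.2)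
  refine (hasDerivAt_integral_of_dominated_loc_of_deriv_le (μ := volume)
    (bound := fun x => ‖k x‖ * max C 0)
    (F' := fun s x => k x • shieldedBeam (deriv g) y u ε (x, s))
    (Metric.closedBall_mem_nhds t one_pos) ?_ ?_ ?_ ?_ ?_ ?_).2
  · exact Eventually.of_forall fun s => (integrable_smul_testFunction
      (locallyIntegrable_shieldedBeam_slice hy hu hε hg s) k).aestronglyMeasurable
  · exact integrable_smul_testFunction (locallyIntegrable_shieldedBeam_slice hy hu hε hg t) k
  · exact (integrable_smul_testFunction
      (locallyIntegrable_shieldedBeam_slice hy hu hε hg' t) k).aestronglyMeasurable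
  · refine Eventually.of_forall fun x s hs => ?_
    rw [norm_smul]
    by_cases hx : x ∈ tsupport k
    · refine mul_le_mul_of_nonneg_left ?_ (norm_nonneg _)
      by_cases h : ε * ‖y‖ < (complexDist y x).re
      · simp only [shieldedBeam, h, if_true]
        exact (hC (x, s) ⟨⟨hx, h.le⟩, hs⟩).trans (le_max_left _ _)
      · simp only [shieldedBeam, h, if_false, norm_zero]
        exact le_max_right _ _
    · simp [image_eq_zero_of_notMem_tsupport hx]
  · exact ((k.continuous.integrable_of_hasCompactSupport k.hasCompactSupport).norm).mul_const _
  · exact Eventually.of_forall fun x s _ =>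
      (hasDerivAt_shieldedBeam hy hu hε hg x s).const_smul (k x)

theorem contDiff_integral_shieldedBeam (hy : y ≠ 0) (hu : ‖y‖ < |u|) (hε : 0 < ε)
    (hg : DifferentiableOn ℂ g {τ | τ.im ≠ 0}) (k : 𝓓((⊤ : TopologicalSpace.Opens Space), ℝ)) :
    ContDiff ℝ ∞ fun t => ∫ x, k x • shieldedBeam g y u ε (x, t) := by
  rw [contDiff_infty]
  intro n
  induction n generalizing g with
  | zero =>
    exact contDiff_zero.2 (continuous_iff_continuousAt.2 fun t =>
      (hasDerivAt_integral_shieldedBeam hy hu hε hg k t).continuousAt)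
  | succ n ih =>
    have hd : deriv (fun t => ∫ x, k x • shieldedBeam g y u ε (x, t)) =
        fun t => ∫ x, k x • shieldedBeam (deriv g) y u ε (x, t) :=
      funext fun t => (hasDerivAt_integral_shieldedBeam hy hu hε hg k t).deriv
    rw [Nat.cast_succ, contDiff_succ_iff_deriv, hd]
    exact ⟨fun t => (hasDerivAt_integral_shieldedBeam hy hu hε hg k t).differentiableAt,
      by simp, ih (differentiableOn_deriv hg)⟩

theorem laplace_timeSlice (F : 𝓓((⊤ : TopologicalSpace.Opens Spacetime), ℝ)) (t : ℝ) (x : Space) :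
    laplace (timeSlice F t) x = (∑ j : Fin 3, ∂_{spaceDir j} (∂_{spaceDir j} F)) (x, t) := by
  have key : ∀ (G : 𝓓((⊤ : TopologicalSpace.Opens Spacetime), ℝ)) (j : Fin 3),
      ∂_{(EuclideanSpace.single j (1 : ℝ) : Space)} (timeSlice G t) =
        timeSlice (∂_{spaceDir j} G) t := by
    intro G j
    ext x
    change (TestFunction.lineDerivCLM ℝ _ (timeSlice G t)) x =
      (TestFunction.lineDerivCLM ℝ (spaceDir j) G) (x, t)
    rw [TestFunction.lineDerivCLM_apply_of_le le_top, TestFunction.lineDerivCLM_apply_of_le le_top]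
    simp only [lineDeriv]
    congr 1
    funext s
    change G (x + s • _, t) = G ((x, t) + s • spaceDir j)
    simp [spaceDir]
  simp only [laplace, key, Fin.sum_univ_three]
  rfl

/-- Integration by parts in time: the derivative falls on the signal. -/
theorem integral_timeDeriv_smul (hy : y ≠ 0) (hu : ‖y‖ < |u|) (hε : 0 < ε)
    (hg : DifferentiableOn ℂ g {τ | τ.im ≠ 0})
    (F : 𝓓((⊤ : TopologicalSpace.Opens Spacetime), ℝ)) :
    ∫ X, (∂_{timeDir} F) X • shieldedBeam g y u ε X =
      -∫ X, F X • shieldedBeam (deriv g) y u ε X := by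
  have h1 := locallyIntegrable_shieldedBeam hy hu hε hg
  have h2 := locallyIntegrable_shieldedBeam hy hu hε (differentiableOn_deriv hg)
  have : Measure.IsAddHaarMeasure (volume : Measure Spacetime) :=
    Measure.prod.instIsAddHaarMeasure _ _
  have hd : ∀ X, HasLineDerivAt ℝ F ((∂_{timeDir} F) X) X timeDir := fun X => by
    have he : (∂_{timeDir} F) X = lineDeriv ℝ F X timeDir :=
      TestFunction.lineDerivCLM_apply_of_le (𝕜 := ℝ) le_top
    rw [he]
    exact ((F.contDiff.differentiable (by simp)) X).lineDifferentiableAt.hasLineDerivAt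
  generalize (∂_{timeDir} F) = G at hd ⊢
  have hbeam : ∀ X, HasLineDerivAt ℝ (shieldedBeam g y u ε) (shieldedBeam (deriv g) y u ε X) X
      timeDir := by
    rintro ⟨x, t⟩
    have := (hasDerivAt_shieldedBeam hy hu hε hg x (t + 0)).comp_const_add t 0
    simpa [HasLineDerivAt, timeDir] using this
  generalize shieldedBeam (deriv g) y u ε = w' at h2 hbeam ⊢
  generalize shieldedBeam g y u ε = w at h1 hbeam ⊢
  have := integral_bilinear_hasLineDerivAt_right_eq_neg_left_of_integrable (μ := volume)
    (B := (ContinuousLinearMap.lsmul ℝ ℝ : ℝ →L[ℝ] ℂ →L[ℝ] ℂ)) (v := timeDir)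
    (f := F) (f' := G) (g := w) (g' := w')
    (integrable_smul_testFunction h1 G) (integrable_smul_testFunction h2 F)
    (integrable_smul_testFunction h1 F) (fun X _ => hd X) (fun X _ => hbeam X)
  simp only [ContinuousLinearMap.lsmul_apply] at this
  rw [this, neg_neg]

/-- The pairing with `S_ε(t)` is a combination of integrals `∫ k W_ε(·, t)`, which are smooth in `t`
since every time derivative falls on the signal; Fubini's theorem assembles the time slices. -/
theorem isRegularInTime_sourceAt (hy : y ≠ 0) (hu : ‖y‖ < |u|) (hε : 0 < ε)
    (hg : DifferentiableOn ℂ g {τ | τ.im ≠ 0}) :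
    IsRegularInTime (shieldedSource g y u ε) (sourceAt g y u ε) := by
  have hg' := differentiableOn_deriv hg
  have hg'' := differentiableOn_deriv hg'
  refine ⟨fun f => ?_, fun F => ?_⟩
  · simp only [sourceAt_apply hy hu hε hg]
    exact (contDiff_integral_shieldedBeam hy hu hε hg'' f).sub
      (contDiff_integral_shieldedBeam hy hu hε hg (laplace f))
  · have h1 := locallyIntegrable_shieldedBeam hy hu hε hg
    have h2 := locallyIntegrable_shieldedBeam hy hu hε hg''
    set L := ∑ j : Fin 3, ∂_{spaceDir j} (∂_{spaceDir j} F)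
    have i1 := integrable_smul_testFunction h1 L
    have i2 := integrable_smul_testFunction h2 F
    have hT : ∀ t, sourceAt g y u ε t (timeSlice F t) =
        (∫ x, F (x, t) • shieldedBeam (deriv (deriv g)) y u ε (x, t)) -
          ∫ x, L (x, t) • shieldedBeam g y u ε (x, t) := fun t => by
      rw [sourceAt_apply hy hu hε hg]
      simp only [laplace_timeSlice]
      rfl
    simp only [hT]
    refine ⟨i2.integral_prod_right.sub i1.integral_prod_right, ?_⟩
    rw [integral_sub i2.integral_prod_right i1.integral_prod_right, ← integral_prod_symm _ i2,
      ← integral_prod_symm _ i1, ← Measure.volume_eq_prod]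
    have hS : shieldedSource g y u ε F =
        toDistribution (shieldedBeam g y u ε) (∂_{timeDir} (∂_{timeDir} F)) -
          toDistribution (shieldedBeam g y u ε) L := by
      simp [shieldedSource, waveOp, L, Fin.sum_univ_three]
    rw [hS, toDistribution_apply h1, toDistribution_apply h1,
      integral_timeDeriv_smul hy hu hε hg, integral_timeDeriv_smul hy hu hε hg', neg_neg]

end

/-! ### Oblate spheroidal coordinates -/

/-- The distance `ρ` from the axis at the coordinates `(p, q)`. -/
def osRadius (a p q : ℝ) : ℝ := Real.sqrt ((p ^ 2 + a ^ 2) * (a ^ 2 - q ^ 2)) / a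

/-- The radial vector at azimuth `φ`, a unit vector when `e₁, e₂` are orthonormal. -/
def radialDir (e₁ e₂ : Space) (φ : ℝ) : Space := Real.cos φ • e₁ + Real.sin φ • e₂

theorem osPoint_eq (y e₁ e₂ : Space) (p q φ : ℝ) :
    osPoint y e₁ e₂ p q φ =
      (p * q / ‖y‖) • (‖y‖⁻¹ • y) + osRadius ‖y‖ p q • radialDir e₁ e₂ φ := rfl

theorem continuous_osRadius (a : ℝ) : Continuous fun v : ℝ × ℝ => osRadius a v.1 v.2 := by
  unfold osRadius; fun_prop

theorem continuous_osPoint (y e₁ e₂ : Space) :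
    Continuous fun v : ℝ × ℝ × ℝ => osPoint y e₁ e₂ v.1 v.2.1 v.2.2 := by
  unfold osPoint; fun_prop

theorem sq_sub_sq_pos {a q : ℝ} (hq : q ∈ Ioo (-a) a) : 0 < a ^ 2 - q ^ 2 := by
  nlinarith [mul_pos (sub_pos.2 hq.1) (sub_pos.2 hq.2)]

theorem sq_sub_sq_nonneg {a q : ℝ} (hq : q ∈ Icc (-a) a) : 0 ≤ a ^ 2 - q ^ 2 := by
  nlinarith [mul_nonneg (sub_nonneg.2 hq.1) (sub_nonneg.2 hq.2)]

theorem osRadius_pos {a p q : ℝ} (ha : 0 < a) (hq : q ∈ Ioo (-a) a) : 0 < osRadius a p q :=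
  div_pos (Real.sqrt_pos.2 (mul_pos (by positivity) (sq_sub_sq_pos hq))) ha

theorem osRadius_sq {a p q : ℝ} (hq : q ∈ Icc (-a) a) :
    osRadius a p q ^ 2 = (p ^ 2 + a ^ 2) * (a ^ 2 - q ^ 2) / a ^ 2 := by
  rw [osRadius, div_pow, Real.sq_sqrt (mul_nonneg (by positivity) (sq_sub_sq_nonneg hq))]

theorem hasFDerivAt_osRadius {a p q : ℝ} (ha : 0 < a) (hq : q ∈ Ioo (-a) a) :
    HasFDerivAt (fun v : ℝ × ℝ => osRadius a v.1 v.2)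
      ((osRadius a p q * p / (p ^ 2 + a ^ 2)) • ContinuousLinearMap.fst ℝ ℝ ℝ -
        (osRadius a p q * q / (a ^ 2 - q ^ 2)) • ContinuousLinearMap.snd ℝ ℝ ℝ) (p, q) := by
  have h1 : HasFDerivAt (fun v : ℝ × ℝ => (v.1 ^ 2 + a ^ 2) * (a ^ 2 - v.2 ^ 2)) _ (p, q) :=
    (((hasFDerivAt_fst (𝕜 := ℝ) (p := (p, q))).pow 2).add_const (a ^ 2)).mul
      (((hasFDerivAt_snd (𝕜 := ℝ) (p := (p, q))).pow 2).const_sub (a ^ 2))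
  have hA : 0 < p ^ 2 + a ^ 2 := by positivity
  have hB := sq_sub_sq_pos hq
  have hAB := mul_pos hA hB
  have hr := Real.sqrt_pos.2 hAB
  have hrr := Real.sq_sqrt hAB.le
  refine ((h1.sqrt hAB.ne').mul_const a⁻¹).congr_fderiv ?_
  ext
  · simp [osRadius]
    field_simp
    rw [hrr]; ring
  · simp [osRadius]
    field_simp
    rw [hrr]; ring

/-- The orthonormality of `e₁, e₂, 𝐲 / |𝐲|` in terms of inner products. -/
theorem frame_inner {y e₁ e₂ : Space} (hy : y ≠ 0) (h : Orthonormal ℝ ![e₁, e₂, ‖y‖⁻¹ • y]) :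
    ⟪e₁, e₁⟫ = 1 ∧ ⟪e₂, e₂⟫ = 1 ∧ ⟪e₁, e₂⟫ = 0 ∧ ⟪e₁, y⟫ = 0 ∧ ⟪e₂, y⟫ = 0 := by
  have hy' : ‖y‖ ≠ 0 := norm_ne_zero_iff.2 hy
  have h0 := h.1 0
  have h1 := h.1 1
  have h01 := h.2 (show (0 : Fin 3) ≠ 1 by decide)
  have h02 := h.2 (show (0 : Fin 3) ≠ 2 by decide)
  have h12 := h.2 (show (1 : Fin 3) ≠ 2 by decide)
  simp [inner_smul_right, hy] at h0 h1 h01 h02 h12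
  refine ⟨?_, ?_, h01, h02, h12⟩
  · rw [real_inner_self_eq_norm_sq, h0, one_pow]
  · rw [real_inner_self_eq_norm_sq, h1, one_pow]

section

variable {y e₁ e₂ : Space}

theorem inner_radialDir (hy : y ≠ 0) (h : Orthonormal ℝ ![e₁, e₂, ‖y‖⁻¹ • y]) (φ : ℝ) :
    ⟪radialDir e₁ e₂ φ, radialDir e₁ e₂ φ⟫ = 1 ∧ ⟪radialDir e₁ e₂ φ, y⟫ = 0 := by
  obtain ⟨h1, h2, h3, h4, h5⟩ := frame_inner hy h
  simp only [radialDir, inner_add_left, inner_add_right, inner_smul_left, inner_smul_right,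
    RCLike.conj_to_real, h1, h2, h3, h4, h5, real_inner_comm e₁ e₂]
  constructor
  · linear_combination Real.cos_sq_add_sin_sq φ
  · ring

theorem inner_osPoint (hy : y ≠ 0) (h : Orthonormal ℝ ![e₁, e₂, ‖y‖⁻¹ • y]) (p q φ : ℝ) :
    ⟪osPoint y e₁ e₂ p q φ, y⟫ = p * q := by
  have hy' : ‖y‖ ≠ 0 := norm_ne_zero_iff.2 hy
  rw [osPoint_eq]
  simp only [inner_add_left, inner_smul_left, RCLike.conj_to_real, (inner_radialDir hy h φ).2,
    real_inner_self_eq_norm_sq]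
  field_simp
  ring

theorem norm_sq_osPoint (hy : y ≠ 0) (h : Orthonormal ℝ ![e₁, e₂, ‖y‖⁻¹ • y]) (p φ : ℝ) {q : ℝ}
    (hq : q ∈ Icc (-‖y‖) ‖y‖) :
    ‖osPoint y e₁ e₂ p q φ‖ ^ 2 = p ^ 2 - q ^ 2 + ‖y‖ ^ 2 := by
  have hy' : ‖y‖ ≠ 0 := norm_ne_zero_iff.2 hy
  have hr := osRadius_sq (p := p) hq
  obtain ⟨h1, h2⟩ := inner_radialDir hy h φ
  rw [← real_inner_self_eq_norm_sq, osPoint_eq]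
  simp only [inner_add_left, inner_add_right, inner_smul_left, inner_smul_right,
    RCLike.conj_to_real, h1, h2, real_inner_comm (radialDir e₁ e₂ φ) y,
    real_inner_self_eq_norm_sq]
  have : osRadius ‖y‖ p q * (osRadius ‖y‖ p q * 1) =
      (p ^ 2 + ‖y‖ ^ 2) * (‖y‖ ^ 2 - q ^ 2) / ‖y‖ ^ 2 := by rw [← hr]; ring
  simp only [mul_zero, add_zero, zero_add]
  rw [this]
  field_simp
  ring

theorem complexDist_osPoint (hy : y ≠ 0) (h : Orthonormal ℝ ![e₁, e₂, ‖y‖⁻¹ • y]) {p : ℝ}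
    (hp : 0 < p) {q : ℝ} (hq : q ∈ Icc (-‖y‖) ‖y‖) (φ : ℝ) :
    complexDist y (osPoint y e₁ e₂ p q φ) = (p : ℂ) - I * (q : ℂ) := by
  apply complexDist_eq_of_sq
  · simpa using hp
  · rw [norm_sq_osPoint hy h p φ hq]; simp
  · rw [inner_osPoint hy h]; simp

/-- The map of the oblate spheroidal coordinates in Cartesian coordinates along the frame. -/
def osMap (a : ℝ) (w : Fin 3 → ℝ) : Fin 3 → ℝ :=
  ![osRadius a (w 0) (w 1) * Real.cos (w 2), osRadius a (w 0) (w 1) * Real.sin (w 2),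
    w 0 * w 1 / a]

/-- The Jacobian matrix of `osMap`. -/
def osJacobian (a : ℝ) (w : Fin 3 → ℝ) : Matrix (Fin 3) (Fin 3) ℝ :=
  let ρ := osRadius a (w 0) (w 1)
  let ρp := ρ * w 0 / (w 0 ^ 2 + a ^ 2)
  let ρq := -(ρ * w 1 / (a ^ 2 - w 1 ^ 2))
  !![ρp * Real.cos (w 2), ρq * Real.cos (w 2), -(ρ * Real.sin (w 2));
    ρp * Real.sin (w 2), ρq * Real.sin (w 2), ρ * Real.cos (w 2);
    w 1 / a, w 0 / a, 0]

theorem hasFDerivAt_osMap {a : ℝ} (ha : 0 < a) {w : Fin 3 → ℝ} (hq : w 1 ∈ Ioo (-a) a) :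
    HasFDerivAt (osMap a) (Matrix.toLin' (osJacobian a w)).toContinuousLinearMap w := by
  have pr : ∀ i : Fin 3, HasFDerivAt (fun w : Fin 3 → ℝ => w i)
      (ContinuousLinearMap.proj (R := ℝ) (φ := fun _ : Fin 3 => ℝ) i) w := fun i =>
    hasFDerivAt_apply i w
  have hρ : HasFDerivAt (fun w : Fin 3 → ℝ => osRadius a (w 0) (w 1)) _ w :=
    HasFDerivAt.comp (g := fun v : ℝ × ℝ => osRadius a v.1 v.2) w
      (hasFDerivAt_osRadius (p := w 0) ha hq) ((pr 0).prodMk (pr 1))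
  have hcos : HasFDerivAt (fun w : Fin 3 → ℝ => Real.cos (w 2)) _ w := (pr 2).cos
  have hsin : HasFDerivAt (fun w : Fin 3 → ℝ => Real.sin (w 2)) _ w := (pr 2).sin
  rw [hasFDerivAt_pi']
  intro i
  fin_cases i
  · refine (hρ.mul hcos).congr_fderiv ?_
    ext v
    simp [osJacobian, Fin.sum_univ_three, dotProduct]
    ring
  · refine (hρ.mul hsin).congr_fderiv ?_
    ext v
    simp [osJacobian, Fin.sum_univ_three, dotProduct]
    ring
  · refine (((pr 0).mul (pr 1)).mul_const a⁻¹).congr_fderiv ?_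
    ext v
    simp [osJacobian, Fin.sum_univ_three, dotProduct]
    ring

theorem det_osJacobian {a : ℝ} (ha : 0 < a) {w : Fin 3 → ℝ} (hq : w 1 ∈ Ioo (-a) a) :
    (osJacobian a w).det = -((w 0 ^ 2 + w 1 ^ 2) / a) := by
  have hr := osRadius_sq (p := w 0) (Ioo_subset_Icc_self hq)
  have hA : 0 < w 0 ^ 2 + a ^ 2 := by positivity
  have hB := sq_sub_sq_pos hq
  have hcs := Real.cos_sq_add_sin_sq (w 2)
  have : (osJacobian a w).det = -(osRadius a (w 0) (w 1) ^ 2 *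
      (Real.cos (w 2) ^ 2 + Real.sin (w 2) ^ 2) *
        (w 0 ^ 2 / (w 0 ^ 2 + a ^ 2) + w 1 ^ 2 / (a ^ 2 - w 1 ^ 2)) / a) := by
    rw [Matrix.det_fin_three]
    simp [osJacobian, -Real.cos_sq_add_sin_sq]
    ring
  rw [this, hr, hcs]
  field_simp
  ring

/-- The coordinate domain in `Fin 3 → ℝ`. -/
def osDomain (a : ℝ) : Set (Fin 3 → ℝ) :=
  {w | 0 < w 0 ∧ w 1 ∈ Ioo (-a) a ∧ w 2 ∈ Ioo 0 (2 * Real.pi)}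

/-- The point with Cartesian coordinates `w` along the frame `e₁, e₂, 𝐲 / |𝐲|`. -/
def framePoint (y e₁ e₂ : Space) (w : Fin 3 → ℝ) : Space :=
  w 0 • e₁ + w 1 • e₂ + w 2 • (‖y‖⁻¹ • y)

theorem framePoint_osMap (y e₁ e₂ : Space) (w : Fin 3 → ℝ) :
    framePoint y e₁ e₂ (osMap ‖y‖ w) = osPoint y e₁ e₂ (w 0) (w 1) (w 2) := by
  rw [osPoint_eq, radialDir, framePoint]
  simp only [osMap, Matrix.cons_val_zero, Matrix.cons_val_one, Matrix.cons_val]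
  module

theorem framePoint_eq_repr (h : Orthonormal ℝ ![e₁, e₂, ‖y‖⁻¹ • y]) :
    ∃ b : OrthonormalBasis (Fin 3) ℝ Space,
      framePoint y e₁ e₂ = fun w => b.repr.symm (WithLp.toLp 2 w) := by
  have hc : Fintype.card (Fin 3) = Module.finrank ℝ Space := by simp
  refine ⟨(basisOfOrthonormalOfCardEqFinrank h hc).toOrthonormalBasis (by simpa using h), ?_⟩
  funext w
  rw [← OrthonormalBasis.sum_repr_symm]
  simp [framePoint, Fin.sum_univ_three]

theorem measurePreserving_framePoint (h : Orthonormal ℝ ![e₁, e₂, ‖y‖⁻¹ • y]) :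
    MeasurePreserving (framePoint y e₁ e₂) ∧ MeasurableEmbedding (framePoint y e₁ e₂) := by
  obtain ⟨b, hb⟩ := framePoint_eq_repr h
  rw [hb]
  exact ⟨b.measurePreserving_repr_symm.comp (PiLp.volume_preserving_toLp (Fin 3)),
    b.repr.symm.toHomeomorph.measurableEmbedding.comp
      (MeasurableEquiv.toLp 2 (Fin 3 → ℝ)).measurableEmbedding⟩

theorem framePoint_inner (hy : y ≠ 0) (h : Orthonormal ℝ ![e₁, e₂, ‖y‖⁻¹ • y]) (w : Fin 3 → ℝ) :
    ‖framePoint y e₁ e₂ w‖ ^ 2 = w 0 ^ 2 + w 1 ^ 2 + w 2 ^ 2 ∧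
      ⟪framePoint y e₁ e₂ w, y⟫ = w 2 * ‖y‖ := by
  have hy' : ‖y‖ ≠ 0 := norm_ne_zero_iff.2 hy
  obtain ⟨h1, h2, h3, h4, h5⟩ := frame_inner hy h
  rw [← real_inner_self_eq_norm_sq, framePoint]
  simp only [inner_add_left, inner_add_right, inner_smul_left, inner_smul_right,
    RCLike.conj_to_real, h1, h2, h3, h4, h5, real_inner_comm e₁ e₂, real_inner_comm e₁ y,
    real_inner_comm e₂ y, real_inner_self_eq_norm_sq]
  constructor <;> field_simp <;> ring

theorem injOn_osMap (hy : y ≠ 0) (h : Orthonormal ℝ ![e₁, e₂, ‖y‖⁻¹ • y]) :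
    InjOn (osMap ‖y‖) (osDomain ‖y‖) := by
  intro w hw w' hw' heq
  have hr := congrArg (fun v => complexDist y (framePoint y e₁ e₂ v)) heq
  simp only [framePoint_osMap] at hr
  rw [complexDist_osPoint hy h hw.1 (Ioo_subset_Icc_self hw.2.1),
    complexDist_osPoint hy h hw'.1 (Ioo_subset_Icc_self hw'.2.1)] at hr
  have h0 : w 0 = w' 0 := by simpa using congrArg re hr
  have h1 : w 1 = w' 1 := by simpa using congrArg im hr
  have hρ := (osRadius_pos (p := w 0) (norm_pos_iff.2 hy) hw.2.1).ne'
  have hc := congrFun heq 0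
  have hs := congrFun heq 1
  simp only [osMap, Matrix.cons_val_zero, Matrix.cons_val_one, ← h0, ← h1] at hc hs
  have hang := Real.Angle.cos_sin_inj (mul_left_cancel₀ hρ hc) (mul_left_cancel₀ hρ hs)
  have h2 : w 2 = w' 2 := by
    obtain ⟨k, hk⟩ := Real.Angle.angle_eq_iff_two_pi_dvd_sub.1 hang
    have ha := hw.2.2
    have hb := hw'.2.2
    have hπ := Real.pi_pos
    have hk1 : (k : ℝ) < 1 := by
      by_contra! hcon
      nlinarith [ha.2, hb.1]
    have hk2 : (-1 : ℝ) < k := by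
      by_contra! hcon
      nlinarith [ha.1, hb.2]
    have hk0 : k = 0 := by
      have : k < 1 := by exact_mod_cast hk1
      have : -1 < k := by exact_mod_cast hk2
      omega
    rw [hk0] at hk
    simp at hk
    linarith
  funext i
  fin_cases i <;> assumption

/-- A plane vector off the first axis has an azimuth in the open interval `(0, 2π)`. -/
theorem exists_azimuth {a b : ℝ} (hb : b ≠ 0) :
    ∃ φ ∈ Ioo 0 (2 * Real.pi), a = Real.sqrt (a ^ 2 + b ^ 2) * Real.cos φ ∧
      b = Real.sqrt (a ^ 2 + b ^ 2) * Real.sin φ := by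
  set z : ℂ := ⟨a, b⟩
  have hn : Real.sqrt (a ^ 2 + b ^ 2) = ‖z‖ := by
    rw [Complex.norm_def, Complex.normSq_mk]; congr 1; ring
  have h1 : a = ‖z‖ * Real.cos (arg z) := (norm_mul_cos_arg z).symm
  have h2 : b = ‖z‖ * Real.sin (arg z) := (norm_mul_sin_arg z).symm
  rw [hn]
  have hne : arg z ≠ 0 := fun h0 => by rw [h0] at h2; simp at h2; exact hb h2
  have hneπ : arg z ≠ Real.pi := fun h0 => by rw [h0] at h2; simp at h2; exact hb h2
  have hle := arg_le_pi z
  have hlt := neg_pi_lt_arg z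
  have hπ := Real.pi_pos
  rcases lt_or_gt_of_ne hne with h0 | h0
  · refine ⟨arg z + 2 * Real.pi, ⟨by linarith, by linarith⟩, ?_, ?_⟩
    · rwa [Real.cos_add_two_pi]
    · rwa [Real.sin_add_two_pi]
  · exact ⟨arg z, ⟨h0, by linarith⟩, h1, h2⟩

/-- The coordinates cover the exterior of the branch disk up to a null set: the missing points lie
in the coordinate plane containing the half plane of azimuth `0`. -/
theorem image_osMap_ae_eq (hy : y ≠ 0) (h : Orthonormal ℝ ![e₁, e₂, ‖y‖⁻¹ • y]) :
    osMap ‖y‖ '' osDomain ‖y‖ =ᵐ[volume]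
      framePoint y e₁ e₂ ⁻¹' {x | 0 < (complexDist y x).re} := by
  have hy' : 0 < ‖y‖ := norm_pos_iff.2 hy
  have hsub : osMap ‖y‖ '' osDomain ‖y‖ ⊆
      framePoint y e₁ e₂ ⁻¹' {x | 0 < (complexDist y x).re} := by
    rintro _ ⟨w, hw, rfl⟩
    change 0 < (complexDist y (framePoint y e₁ e₂ (osMap ‖y‖ w))).re
    rw [framePoint_osMap, complexDist_osPoint hy h hw.1 (Ioo_subset_Icc_self hw.2.1)]
    simpa using hw.1
  have hnull : volume {w : Fin 3 → ℝ | w 1 = 0} = 0 := by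
    have : {w : Fin 3 → ℝ | w 1 = 0} =
        (LinearMap.ker (LinearMap.proj (R := ℝ) (φ := fun _ : Fin 3 => ℝ) 1) :
          Submodule ℝ (Fin 3 → ℝ)) := by
      ext w; simp
    rw [this]
    refine Measure.addHaar_submodule _ _ fun htop => ?_
    have : (fun _ => 1 : Fin 3 → ℝ) ∈
        LinearMap.ker (LinearMap.proj (R := ℝ) (φ := fun _ : Fin 3 => ℝ) 1) := by
      rw [htop]; trivial
    simp at this
  refine hsub.eventuallyLE.antisymm (ae_le_set.2 (measure_mono_null ?_ hnull))
  -- off the half plane the coordinates are read off from `r̃ = p - iq` and the azimuth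
  rintro w ⟨hw, hnot⟩
  by_contra hw1
  change w 1 ≠ 0 at hw1
  apply hnot
  obtain ⟨hn, hi⟩ := framePoint_inner hy h w
  set x := framePoint y e₁ e₂ w
  set p := (complexDist y x).re with hp
  set q := -(complexDist y x).im with hq
  have e1 := re_sq_sub_im_sq y x
  have e2 := re_mul_im y x
  have hp0 : 0 < p := hw
  have hpq : p * q = w 2 * ‖y‖ := by rw [hq, mul_neg, e2, hi, neg_neg]
  have hpq2 : p ^ 2 - q ^ 2 = w 0 ^ 2 + w 1 ^ 2 + w 2 ^ 2 - ‖y‖ ^ 2 := by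
    rw [hq, neg_sq, e1, hn]
  have hw2 : w 2 = p * q / ‖y‖ := by rw [hpq]; field_simp
  have hρ : w 0 ^ 2 + w 1 ^ 2 = (p ^ 2 + ‖y‖ ^ 2) * (‖y‖ ^ 2 - q ^ 2) / ‖y‖ ^ 2 := by
    rw [show w 0 ^ 2 + w 1 ^ 2 = p ^ 2 - q ^ 2 + ‖y‖ ^ 2 - w 2 ^ 2 by linarith, hw2]
    field_simp
    ring
  have hqa : q ∈ Ioo (-‖y‖) ‖y‖ := by
    refine abs_lt.1 (abs_lt_of_sq_lt_sq ?_ hy'.le)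
    have hpos : 0 < w 0 ^ 2 + w 1 ^ 2 := by positivity
    rw [hρ, div_pos_iff_of_pos_right (by positivity)] at hpos
    exact sub_pos.1 (pos_of_mul_pos_right hpos (by positivity))
  obtain ⟨φ, hφ, hc, hs⟩ := exists_azimuth (a := w 0) hw1
  have hr : Real.sqrt (w 0 ^ 2 + w 1 ^ 2) = osRadius ‖y‖ p q := by
    rw [hρ, osRadius, Real.sqrt_div' _ (by positivity), Real.sqrt_sq hy'.le]
  rw [hr] at hc hs
  refine ⟨![p, q, φ], ⟨hp0, hqa, hφ⟩, ?_⟩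
  funext i
  fin_cases i
  · exact hc.symm
  · exact hs.symm
  · exact hw2.symm

theorem measurableSet_osDomain (a : ℝ) : MeasurableSet (osDomain a) := by
  have h : osDomain a = (fun w : Fin 3 → ℝ => w 0) ⁻¹' Ioi 0 ∩
      ((fun w : Fin 3 → ℝ => w 1) ⁻¹' Ioo (-a) a ∩
        (fun w : Fin 3 → ℝ => w 2) ⁻¹' Ioo 0 (2 * Real.pi)) := rfl
  rw [h]
  exact (measurable_pi_apply 0 measurableSet_Ioi).inter
    ((measurable_pi_apply 1 measurableSet_Ioo).inter (measurable_pi_apply 2 measurableSet_Ioo))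

/-- The splitting `w ↦ (w₀, (w₁, w₂))`. -/
def splitThree (w : Fin 3 → ℝ) : ℝ × ℝ × ℝ := (w 0, w 1, w 2)

theorem measurePreserving_splitThree :
    MeasurePreserving splitThree ∧ MeasurableEmbedding splitThree := by
  have h1 := volume_preserving_piFinSuccAbove (fun _ : Fin 3 => ℝ) 0
  have h2 := (MeasurePreserving.id (volume : Measure ℝ)).prod
    (volume_preserving_finTwoArrow ℝ)
  have he : splitThree = Prod.map id (MeasurableEquiv.finTwoArrow (α := ℝ)) ∘
      MeasurableEquiv.piFinSuccAbove (fun _ : Fin 3 => ℝ) 0 := rfl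
  refine ⟨he ▸ h2.comp h1, ?_⟩
  rw [he]
  exact (MeasurableEmbedding.id.prodMap MeasurableEquiv.finTwoArrow.measurableEmbedding).comp
    (MeasurableEquiv.measurableEmbedding _)

/-- The volume element is `d𝐱 = a⁻¹ |r̃|² dp dq dφ`. -/
theorem integral_osPoint (hy : y ≠ 0) (h : Orthonormal ℝ ![e₁, e₂, ‖y‖⁻¹ • y]) (G : Space → ℂ) :
    (∫ x in {x | 0 < (complexDist y x).re}, G x =
      ∫ v in Ioi 0 ×ˢ osRange ‖y‖, ((v.1 ^ 2 + v.2.1 ^ 2) / ‖y‖) •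
        G (osPoint y e₁ e₂ v.1 v.2.1 v.2.2)) ∧
    (IntegrableOn G {x | 0 < (complexDist y x).re} ↔
      IntegrableOn (fun v : ℝ × ℝ × ℝ => ((v.1 ^ 2 + v.2.1 ^ 2) / ‖y‖) •
        G (osPoint y e₁ e₂ v.1 v.2.1 v.2.2)) (Ioi 0 ×ˢ osRange ‖y‖)) := by
  have hy' : 0 < ‖y‖ := norm_pos_iff.2 hy
  obtain ⟨m1, m2⟩ := measurePreserving_framePoint h
  obtain ⟨s1, s2⟩ := measurePreserving_splitThree
  have hdet : ∀ w ∈ osDomain ‖y‖,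
      |((Matrix.toLin' (osJacobian ‖y‖ w)).toContinuousLinearMap).det| •
        G (framePoint y e₁ e₂ (osMap ‖y‖ w)) =
      ((w 0 ^ 2 + w 1 ^ 2) / ‖y‖) • G (osPoint y e₁ e₂ (w 0) (w 1) (w 2)) := fun w hw => by
    rw [framePoint_osMap, LinearMap.det_toContinuousLinearMap, LinearMap.det_toLin',
      det_osJacobian hy' hw.2.1, abs_neg, abs_of_nonneg (by positivity)]
  have hdom : osDomain ‖y‖ = splitThree ⁻¹' (Ioi 0 ×ˢ osRange ‖y‖) := rfl
  have hderiv : ∀ w ∈ osDomain ‖y‖, HasFDerivWithinAt (osMap ‖y‖)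
      (Matrix.toLin' (osJacobian ‖y‖ w)).toContinuousLinearMap (osDomain ‖y‖) w := fun w hw =>
    (hasFDerivAt_osMap hy' hw.2.1).hasFDerivWithinAt
  have hm := measurableSet_osDomain ‖y‖
  constructor
  · rw [← m1.setIntegral_preimage_emb m2, ← setIntegral_congr_set (image_osMap_ae_eq hy h),
      integral_image_eq_integral_abs_det_fderiv_smul volume hm hderiv (injOn_osMap hy h),
      setIntegral_congr_fun hm hdet, ← s1.setIntegral_preimage_emb s2, ← hdom]
    rfl
  · rw [← m1.integrableOn_comp_preimage m2, ← integrableOn_congr_set_ae (image_osMap_ae_eq hy h),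
      integrableOn_image_iff_integrableOn_abs_det_fderiv_smul volume hm hderiv (injOn_osMap hy h),
      ← s1.integrableOn_comp_preimage s2, ← hdom]
    exact integrableOn_congr_fun hdet hm

end

/-! ### Green's identity with a radial cutoff -/

/-- The gradient of `p = Re r̃`, that is `(p 𝐱 + q 𝐲) / (p² + q²)`. -/
def gradRe (y x : Space) : Space :=
  (normSq (complexDist y x))⁻¹ • ((complexDist y x).re • x - (complexDist y x).im • y)

theorem re_inv_mul_sepForm (y x v : Space) :
    ((complexDist y x)⁻¹ * sepForm y x v).re = ⟪gradRe y x, v⟫ := by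
  simp only [gradRe, sepForm_apply, inner_smul_left, inner_sub_left, RCLike.conj_to_real]
  simp
  ring

theorem sepForm_gradRe {y x : Space} (hx : 0 < (complexDist y x).re) :
    sepForm y x (gradRe y x) =
      ((((complexDist y x).re ^ 2 + ‖y‖ ^ 2) / normSq (complexDist y x) : ℝ) : ℂ) *
        complexDist y x := by
  have e1 := re_sq_sub_im_sq y x
  have e2 := re_mul_im y x
  have hN : normSq (complexDist y x) ≠ 0 := by
    rw [Ne, normSq_eq_zero]; intro h; simp [h] at hx
  rw [sepForm_apply, gradRe]
  set p := (complexDist y x).re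
  set q := (complexDist y x).im
  set N := normSq (complexDist y x)
  simp only [inner_smul_right, inner_sub_right, real_inner_self_eq_norm_sq, real_inner_comm x y]
  have hx2 : ‖x‖ ^ 2 = p ^ 2 - q ^ 2 + ‖y‖ ^ 2 := by linarith
  have hxy : (⟪x, y⟫ : ℝ) = -(p * q) := by linarith
  rw [hx2, hxy]
  apply Complex.ext
  · simp only [sub_re, ofReal_re, mul_re, I_re, I_im, ofReal_im]
    field_simp
    ring
  · simp only [sub_im, ofReal_re, mul_im, I_re, I_im, ofReal_im]
    field_simp
    ring

theorem sum_inner_single {F : Type*} [NormedAddCommGroup F] [NormedSpace ℝ F]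
    (L : Space →L[ℝ] F) (v : Space) :
    ∑ j : Fin 3, ⟪v, EuclideanSpace.single j (1 : ℝ)⟫ • L (EuclideanSpace.single j 1) = L v := by
  have := (EuclideanSpace.basisFun (Fin 3) ℝ).sum_repr' v
  simp only [EuclideanSpace.basisFun_apply] at this
  conv_rhs => rw [← this]
  simp only [map_sum, map_smul, real_inner_comm v]

theorem sum_sepForm_sq (y x : Space) :
    ∑ j : Fin 3, sepForm y x (EuclideanSpace.single j 1) ^ 2 = complexDist y x ^ 2 := by
  rw [complexDist_sq, ← sum_sq_eq]
  refine Finset.sum_congr rfl fun j _ => ?_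
  simp [EuclideanSpace.inner_single_right]

/-- Integration by parts against a test function. -/
theorem integral_lineDeriv_smul {A : Space → ℂ} {A' : Space → Space →L[ℝ] ℂ} {v : Space}
    (hA : ∀ x, HasFDerivAt A (A' x) x) (hA' : Continuous fun x => A' x v)
    (f : 𝓓((⊤ : TopologicalSpace.Opens Space), ℝ)) :
    ∫ x, (∂_{v} f) x • A x = -∫ x, f x • A' x v := by
  have hAc : Continuous A := continuous_iff_continuousAt.2 fun x => (hA x).continuousAt
  have hd : ∀ x, HasLineDerivAt ℝ f ((∂_{v} f) x) x v := fun x => by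
    have he : (∂_{v} f) x = lineDeriv ℝ f x v :=
      TestFunction.lineDerivCLM_apply_of_le (𝕜 := ℝ) le_top
    rw [he]
    exact ((f.contDiff.differentiable (by simp)) x).lineDifferentiableAt.hasLineDerivAt
  generalize (∂_{v} f) = G at hd ⊢
  have := integral_bilinear_hasLineDerivAt_right_eq_neg_left_of_integrable (μ := volume)
    (B := (ContinuousLinearMap.lsmul ℝ ℝ : ℝ →L[ℝ] ℂ →L[ℝ] ℂ)) (v := v)
    (f := f) (f' := G) (g := A) (g' := fun x => A' x v)
    (integrable_smul_testFunction hAc.locallyIntegrable G)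
    (integrable_smul_testFunction hA'.locallyIntegrable f)
    (integrable_smul_testFunction hAc.locallyIntegrable f) (fun x _ => hd x)
    (fun x _ => (hA x).hasLineDerivAt v)
  simp only [ContinuousLinearMap.lsmul_apply] at this
  rw [this, neg_neg]

section

variable {y : Space} {c : ℝ} {χ : ℝ → ℝ}

/-- Every point has a neighbourhood in the exterior of the branch disk or one where the cutoff
vanishes. -/
theorem re_pos_or_eventually_lt (y : Space) (hc : 0 < c) (x : Space) :
    0 < (complexDist y x).re ∨ ∀ᶠ x' in 𝓝 x, (complexDist y x').re < c := by
  by_cases h : 0 < (complexDist y x).re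
  · exact Or.inl h
  · exact Or.inr ((continuous_complexDist_re y).continuousAt.eventually_lt continuousAt_const
      ((not_lt.1 h).trans_lt hc))

theorem continuous_cutoff {F : Type*} [NormedAddCommGroup F] [NormedSpace ℝ F] (hc : 0 < c)
    (hχ : Continuous χ) (hχ0 : ∀ s < c, χ s = 0) {K : Space → F}
    (hK : ∀ x, 0 < (complexDist y x).re → ContinuousAt K x) :
    Continuous fun x => χ (complexDist y x).re • K x := by
  refine continuous_iff_continuousAt.2 fun x => ?_
  rcases re_pos_or_eventually_lt y hc x with h | h
  · exact (hχ.comp (continuous_complexDist_re y)).continuousAt.smul (hK x h)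
  · exact (continuousAt_const (y := (0 : F))).congr (h.mono fun x' hx' => by simp [hχ0 _ hx'])

theorem deriv_eq_zero_of_lt (hχ0 : ∀ s < c, χ s = 0) : ∀ s < c, deriv χ s = 0 := fun s hs => by
  have : χ =ᶠ[𝓝 s] fun _ => 0 := (eventually_lt_nhds hs).mono hχ0
  rw [this.deriv_eq, deriv_const]

/-- The derivative of a function cut off near the branch disk. -/
theorem hasFDerivAt_cutoff (hc : 0 < c) (hχ : Differentiable ℝ χ) (hχ0 : ∀ s < c, χ s = 0)
    {K : Space → ℂ} {K' : Space → Space →L[ℝ] ℂ}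
    (hK : ∀ x, 0 < (complexDist y x).re → HasFDerivAt K (K' x) x) (x : Space) :
    HasFDerivAt (fun x => χ (complexDist y x).re • K x)
      (χ (complexDist y x).re • K' x +
        (deriv χ (complexDist y x).re • innerSL ℝ (gradRe y x)).smulRight (K x)) x := by
  rcases re_pos_or_eventually_lt y hc x with h | h
  · have hp : HasFDerivAt (fun x => (complexDist y x).re) (innerSL ℝ (gradRe y x)) x := by
      refine (reCLM.hasFDerivAt.comp x (hasFDerivAt_complexDist h)).congr_fderiv ?_
      ext v
      simpa only [ContinuousLinearMap.comp_apply, _root_.smul_apply, smul_eq_mul, reCLM_apply,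
        innerSL_apply_apply] using re_inv_mul_sepForm y x v
    exact ((hχ _).hasDerivAt.comp_hasFDerivAt x hp).smul (hK x h)
  · rw [hχ0 _ h.self_of_nhds, deriv_eq_zero_of_lt hχ0 _ h.self_of_nhds]
    simp only [zero_smul]
    refine ((hasFDerivAt_const (0 : ℂ) x).congr_of_eventuallyEq
      (h.mono fun x' hx' => by simp [hχ0 _ hx'])).congr_fderiv ?_
    ext v; simp

end

section

variable {y : Space} {u : ℝ} {g : ℂ → ℂ}

/-- The derivative `h'` of the profile. -/
def profileDeriv (g : ℂ → ℂ) (u t : ℝ) (z : ℂ) : ℂ :=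
  -profile (deriv g) u t z - profile g u t z / z

theorem continuousAt_profile (hg : DifferentiableOn ℂ g {τ | τ.im ≠ 0}) (t : ℝ) {z : ℂ}
    (hz : z ∈ halfStrip u) : ContinuousAt (profile g u t) z :=
  (hasDerivAt_profile hg t hz).continuousAt

theorem continuousAt_profileDeriv (hg : DifferentiableOn ℂ g {τ | τ.im ≠ 0}) (t : ℝ) {z : ℂ}
    (hz : z ∈ halfStrip u) : ContinuousAt (profileDeriv g u t) z :=
  (continuousAt_profile (differentiableOn_deriv hg) t hz).neg.sub
    ((continuousAt_profile hg t hz).div continuousAt_id (ne_zero_of_mem_halfStrip hz))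

/-- The radial derivative of `h' / z`, written with the wave equation `h'' + 2 h' / z = ∂ₜ² h` for
the profile. -/
theorem hasDerivAt_profileDeriv_div (hg : DifferentiableOn ℂ g {τ | τ.im ≠ 0}) (t : ℝ) {z : ℂ}
    (hz : z ∈ halfStrip u) :
    HasDerivAt (fun z => profileDeriv g u t z / z)
      ((profile (deriv (deriv g)) u t z - 3 * (profileDeriv g u t z / z)) / z) z := by
  have hz0 := ne_zero_of_mem_halfStrip hz
  have h1 := (hasDerivAt_profile (differentiableOn_deriv hg) t hz).neg.sub
    ((hasDerivAt_profile hg t hz).div (hasDerivAt_id z) hz0)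
  refine (h1.div (hasDerivAt_id z) hz0).congr_deriv ?_
  simp only [profileDeriv, id, Pi.neg_apply, Pi.sub_apply, Pi.div_apply]
  field_simp
  ring

theorem hasFDerivAt_profile_complexDist (hy : y ≠ 0) (hu : ‖y‖ < |u|)
    (hg : DifferentiableOn ℂ g {τ | τ.im ≠ 0}) (t : ℝ) {x : Space}
    (hx : 0 < (complexDist y x).re) :
    HasFDerivAt (fun x => profile g u t (complexDist y x))
      ((profileDeriv g u t (complexDist y x) / complexDist y x) • sepForm y x) x := by
  refine (HasDerivAt.comp_hasFDerivAt (𝕜 := ℝ) (𝕜' := ℂ) x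
    (hasDerivAt_profile hg t (complexDist_mem_halfStrip hy hu hx))
    (hasFDerivAt_complexDist hx)).congr_fderiv ?_
  ext v
  simp only [_root_.smul_apply, smul_eq_mul, profileDeriv]
  ring

/-- The derivative of the partial derivative `∂_v W = (h'(r̃) / r̃) (𝐱 - i𝐲) · v`. -/
theorem hasFDerivAt_partial_profile (hy : y ≠ 0) (hu : ‖y‖ < |u|)
    (hg : DifferentiableOn ℂ g {τ | τ.im ≠ 0}) (t : ℝ) (v : Space) {x : Space}
    (hx : 0 < (complexDist y x).re) :
    HasFDerivAt
      (fun x => profileDeriv g u t (complexDist y x) / complexDist y x * sepForm y x v)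
      ((profileDeriv g u t (complexDist y x) / complexDist y x) • (ofRealCLM ∘L innerSL ℝ v) +
        (((profile (deriv (deriv g)) u t (complexDist y x) -
          3 * (profileDeriv g u t (complexDist y x) / complexDist y x)) / complexDist y x ^ 2) *
            sepForm y x v) • sepForm y x) x := by
  have h1 := HasDerivAt.comp_hasFDerivAt (𝕜 := ℝ) (𝕜' := ℂ) x
    (hasDerivAt_profileDeriv_div hg t (complexDist_mem_halfStrip hy hu hx))
    (hasFDerivAt_complexDist hx)
  have h2 : HasFDerivAt (fun x => sepForm y x v) (ofRealCLM ∘L innerSL ℝ v) x := by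
    simp only [sepForm_apply]
    refine HasFDerivAt.sub_const _ ?_
    refine (ofRealCLM.hasFDerivAt.comp x ((innerSL ℝ v).hasFDerivAt)).congr_of_eventuallyEq
      (Eventually.of_forall fun x' => ?_)
    simp [real_inner_comm]
  refine (h1.mul h2).congr_fderiv ?_
  ext w
  simp only [_root_.smul_apply, _root_.add_apply, smul_eq_mul, Function.comp_apply]
  rw [sq]
  ring

/-- The flux density `f ∇p · ∇W - W ∇p · ∇f` through the surfaces of constant `p`. -/
def flux (g : ℂ → ℂ) (y : Space) (u t : ℝ) (f : Space → ℝ) (x : Space) : ℂ :=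
  f x • (profileDeriv g u t (complexDist y x) / complexDist y x * sepForm y x (gradRe y x)) -
    fderiv ℝ f x (gradRe y x) • profile g u t (complexDist y x)

theorem continuousAt_gradRe {x : Space} (hx : 0 < (complexDist y x).re) :
    ContinuousAt (gradRe y) x := by
  have hR := continuousAt_complexDist hx
  have hN : normSq (complexDist y x) ≠ 0 := by
    rw [Ne, normSq_eq_zero]; intro h; simp [h] at hx
  exact ((continuous_normSq.continuousAt.comp hR).inv₀ hN).smul
    (((continuous_re.continuousAt.comp hR).smul continuousAt_id).sub
      ((continuous_im.continuousAt.comp hR).smul continuousAt_const))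

theorem continuousAt_flux (hy : y ≠ 0) (hu : ‖y‖ < |u|)
    (hg : DifferentiableOn ℂ g {τ | τ.im ≠ 0}) (t : ℝ)
    (f : 𝓓((⊤ : TopologicalSpace.Opens Space), ℝ)) {x : Space} (hx : 0 < (complexDist y x).re) :
    ContinuousAt (flux g y u t f) x := by
  have hR := continuousAt_complexDist hx
  have hz := complexDist_mem_halfStrip hy hu hx
  have hG := continuousAt_gradRe hx
  have hf' : Continuous (fderiv ℝ f) := f.contDiff.continuous_fderiv (by simp)
  refine (f.continuous.continuousAt.smul ((((continuousAt_profileDeriv hg t hz).comp hR).div hR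
    (ne_zero_of_mem_halfStrip hz)).mul ?_)).sub
    ((hf'.continuousAt.clm_apply hG).smul ((continuousAt_profile hg t hz).comp hR))
  exact (continuous_sepForm y).continuousAt.clm_apply hG

theorem integrable_of_continuous_smul {A : Space → ℂ} (hA : Continuous A)
    (f : 𝓓((⊤ : TopologicalSpace.Opens Space), ℝ)) : Integrable fun x => f x • A x :=
  integrable_smul_testFunction hA.locallyIntegrable f

variable {c : ℝ} {χ : ℝ → ℝ}

/-- Green's identity for one Cartesian coordinate, from two integrations by parts: with `r̃` for the
complex distance, `k v² + m ((𝐱 - i𝐲) · v)²` is the second derivative of `W` along `v`. -/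
theorem green_coord (hy : y ≠ 0) (hu : ‖y‖ < |u|)
    (hg : DifferentiableOn ℂ g {τ | τ.im ≠ 0}) (t : ℝ) (hc : 0 < c) (hχ : ContDiff ℝ 1 χ)
    (hχ0 : ∀ s < c, χ s = 0) (f : 𝓓((⊤ : TopologicalSpace.Opens Space), ℝ)) (v : Space) :
    let k := fun x => profileDeriv g u t (complexDist y x) / complexDist y x
    let m := fun x => (profile (deriv (deriv g)) u t (complexDist y x) - 3 * k x) /
      complexDist y x ^ 2
    Integrable (fun x => f x • (χ (complexDist y x).re •
      (k x * (⟪v, v⟫ : ℝ) + m x * sepForm y x v ^ 2))) ∧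
    Integrable (fun x => f x • (deriv χ (complexDist y x).re •
      (⟪gradRe y x, v⟫ • (k x * sepForm y x v)))) ∧
    Integrable (fun x => (∂_{v} f) x • (deriv χ (complexDist y x).re •
      (⟪gradRe y x, v⟫ • profile g u t (complexDist y x)))) ∧
    ∫ x, (∂_{v} (∂_{v} f)) x • (χ (complexDist y x).re • profile g u t (complexDist y x)) =
      (∫ x, f x • (χ (complexDist y x).re • (k x * (⟪v, v⟫ : ℝ) + m x * sepForm y x v ^ 2))) +
      (∫ x, f x • (deriv χ (complexDist y x).re • (⟪gradRe y x, v⟫ • (k x * sepForm y x v)))) -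
      ∫ x, (∂_{v} f) x • (deriv χ (complexDist y x).re •
        (⟪gradRe y x, v⟫ • profile g u t (complexDist y x))) := by
  intro k m
  have hχd : Differentiable ℝ χ := hχ.differentiable one_ne_zero
  have hχc := hχ.continuous
  have hχ'c : Continuous (deriv χ) := hχ.continuous_deriv le_rfl
  have hχ'0 := deriv_eq_zero_of_lt hχ0
  have hg'' := differentiableOn_deriv (differentiableOn_deriv hg)
  have cR : ∀ x, 0 < (complexDist y x).re → ContinuousAt (complexDist y) x :=
    fun x hx => continuousAt_complexDist hx
  have ck : ∀ x, 0 < (complexDist y x).re → ContinuousAt k x := fun x hx =>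
    have hz := complexDist_mem_halfStrip hy hu hx
    ((continuousAt_profileDeriv hg t hz).comp (cR x hx)).div (cR x hx)
      (ne_zero_of_mem_halfStrip hz)
  have cP : ∀ x, 0 < (complexDist y x).re →
      ContinuousAt (fun x => profile g u t (complexDist y x)) x := fun x hx =>
    (continuousAt_profile hg t (complexDist_mem_halfStrip hy hu hx)).comp (cR x hx)
  have cm : ∀ x, 0 < (complexDist y x).re → ContinuousAt m x := fun x hx => by
    have hz := complexDist_mem_halfStrip hy hu hx
    exact (((continuousAt_profile hg'' t hz).comp (cR x hx)).sub
      (continuousAt_const.mul (ck x hx))).div ((cR x hx).pow 2)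
      (pow_ne_zero 2 (ne_zero_of_mem_halfStrip hz))
  have cs : Continuous fun x => sepForm y x v := (continuous_sepForm y).clm_apply continuous_const
  have cg : ∀ x, 0 < (complexDist y x).re → ContinuousAt (fun x => (⟪gradRe y x, v⟫ : ℝ)) x :=
    fun x hx => (continuousAt_gradRe hx).inner continuousAt_const
  have c1 := continuous_cutoff hc hχc hχ0 (K := fun x =>
      k x * (⟪v, v⟫ : ℝ) + m x * sepForm y x v ^ 2) fun x hx =>
    ((ck x hx).mul continuousAt_const).add ((cm x hx).mul (cs.continuousAt.pow 2))
  have c2 := continuous_cutoff hc hχ'c hχ'0 (K := fun x =>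
      (⟪gradRe y x, v⟫ : ℝ) • (k x * sepForm y x v)) fun x hx =>
    (cg x hx).smul ((ck x hx).mul cs.continuousAt)
  have c3 := continuous_cutoff hc hχ'c hχ'0 (K := fun x =>
      (⟪gradRe y x, v⟫ : ℝ) • profile g u t (complexDist y x)) fun x hx =>
    (cg x hx).smul (cP x hx)
  have c4 := continuous_cutoff hc hχc hχ0 (K := fun x => k x * sepForm y x v) fun x hx =>
    (ck x hx).mul cs.continuousAt
  have i1 := integrable_of_continuous_smul c1 f
  have i2 := integrable_of_continuous_smul c2 f
  have i3 := integrable_of_continuous_smul c3 (∂_{v} f)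
  have i4 := integrable_of_continuous_smul c4 (∂_{v} f)
  refine ⟨i1, i2, i3, ?_⟩
  have d1 : ∀ x, HasFDerivAt _ _ x := hasFDerivAt_cutoff (y := y) hc hχd hχ0
    (K := fun x => profile g u t (complexDist y x)) (K' := fun x => k x • sepForm y x)
    fun x hx => hasFDerivAt_profile_complexDist hy hu hg t hx
  have d2 : ∀ x, HasFDerivAt _ _ x := hasFDerivAt_cutoff (y := y) hc hχd hχ0
    (K := fun x => k x * sepForm y x v)
    (K' := fun x => k x • (ofRealCLM ∘L innerSL ℝ v) + (m x * sepForm y x v) • sepForm y x)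
    fun x hx => hasFDerivAt_partial_profile hy hu hg t v hx
  have e1 : ∀ x, (χ (complexDist y x).re • k x • sepForm y x +
      (deriv χ (complexDist y x).re • innerSL ℝ (gradRe y x)).smulRight
        (profile g u t (complexDist y x))) v =
      χ (complexDist y x).re • (k x * sepForm y x v) + deriv χ (complexDist y x).re •
        ((⟪gradRe y x, v⟫ : ℝ) • profile g u t (complexDist y x)) := fun x => by
    simp [-sepForm_apply, mul_assoc]
  have e2 : ∀ x, (χ (complexDist y x).re • (k x • (ofRealCLM ∘L innerSL ℝ v) +
      (m x * sepForm y x v) • sepForm y x) +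
      (deriv χ (complexDist y x).re • innerSL ℝ (gradRe y x)).smulRight
        (k x * sepForm y x v)) v =
      χ (complexDist y x).re • (k x * (⟪v, v⟫ : ℝ) + m x * sepForm y x v ^ 2) +
        deriv χ (complexDist y x).re • ((⟪gradRe y x, v⟫ : ℝ) • (k x * sepForm y x v)) := fun x => by
    simp [-sepForm_apply]
    ring
  have b1 := integral_lineDeriv_smul (v := v) d1 (by simp only [e1]; exact c4.add c3) (∂_{v} f)
  have b2 := integral_lineDeriv_smul (v := v) d2 (by simp only [e2]; exact c1.add c2) f
  simp only [e1, smul_add] at b1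
  simp only [e2] at b2
  have b3 : ∫ x, (∂_{v} f) x • (χ (complexDist y x).re • (k x * sepForm y x v)) =
      -((∫ x, f x • (χ (complexDist y x).re • (k x * (⟪v, v⟫ : ℝ) + m x * sepForm y x v ^ 2))) +
        ∫ x, f x • (deriv χ (complexDist y x).re • (⟪gradRe y x, v⟫ • (k x * sepForm y x v)))) := by
    rw [b2, ← integral_add i1 i2]
    simp only [smul_add]
  rw [integral_add i4 i3, b3] at b1
  rw [b1]
  ring

/-- Green's identity for the cut off beam: since `ΔW = ∂ₜ² W` off the branch disk, only the flux
through the transition region of the cutoff remains. -/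
theorem green_cutoff (hy : y ≠ 0) (hu : ‖y‖ < |u|)
    (hg : DifferentiableOn ℂ g {τ | τ.im ≠ 0}) (t : ℝ) (hc : 0 < c) (hχ : ContDiff ℝ 1 χ)
    (hχ0 : ∀ s < c, χ s = 0) (f : 𝓓((⊤ : TopologicalSpace.Opens Space), ℝ)) :
    ∫ x, laplace f x • (χ (complexDist y x).re • profile g u t (complexDist y x)) =
      (∫ x, f x • (χ (complexDist y x).re • profile (deriv (deriv g)) u t (complexDist y x))) +
        ∫ x, deriv χ (complexDist y x).re • flux g y u t f x := by
  have cP : Continuous fun x => χ (complexDist y x).re • profile g u t (complexDist y x) :=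
    continuous_cutoff hc hχ.continuous hχ0 fun x hx =>
      (continuousAt_profile hg t (complexDist_mem_halfStrip hy hu hx)).comp
        (continuousAt_complexDist hx)
  have G := fun j : Fin 3 => green_coord hy hu hg t hc hχ hχ0 f (EuclideanSpace.single j (1 : ℝ))
  simp only at G
  have hL : ∀ x, laplace f x = ∑ j : Fin 3, (∂_{(EuclideanSpace.single j (1 : ℝ) : Space)}
      (∂_{(EuclideanSpace.single j (1 : ℝ) : Space)} f)) x := fun x => by
    simp only [laplace, Fin.sum_univ_three]; rfl
  simp only [hL, Finset.sum_smul]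
  rw [integral_finsetSum _ fun j _ => integrable_of_continuous_smul cP _,
    Finset.sum_congr rfl fun j _ => (G j).2.2.2, Finset.sum_sub_distrib, Finset.sum_add_distrib,
    ← integral_finsetSum _ fun j _ => (G j).1, ← integral_finsetSum _ fun j _ => (G j).2.1,
    ← integral_finsetSum _ fun j _ => (G j).2.2.1, add_sub_assoc, ← integral_sub
      (integrable_finsetSum _ fun j _ => (G j).2.1) (integrable_finsetSum _ fun j _ => (G j).2.2.1)]
  congr 1
  · refine integral_congr_ae (Eventually.of_forall fun x => ?_)
    simp only
    rcases re_pos_or_eventually_lt y hc x with hx | hx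
    -- `∑ (𝐱 - i𝐲)ⱼ² = r̃²`, so the second derivatives sum to `3 k + m r̃² = ∂ₜ² W`
    · rw [← Finset.smul_sum, ← Finset.smul_sum, Finset.sum_add_distrib, ← Finset.mul_sum,
        ← Finset.mul_sum, sum_sepForm_sq]
      have hR := ne_zero_of_mem_halfStrip (complexDist_mem_halfStrip hy hu hx)
      congr 2
      simp
      field_simp
      ring
    · simp [hχ0 _ hx.self_of_nhds]
  · refine integral_congr_ae (Eventually.of_forall fun x => ?_)
    simp only [flux]
    have h1 := sum_inner_single (sepForm y x) (gradRe y x)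
    have h2 := sum_inner_single (fderiv ℝ f x) (gradRe y x)
    have h3 : ∀ j : Fin 3, (∂_{(EuclideanSpace.single j (1 : ℝ) : Space)} f) x =
        fderiv ℝ f x (EuclideanSpace.single j 1) := fun j => by
      have he : (∂_{(EuclideanSpace.single j (1 : ℝ) : Space)} f) x =
          lineDeriv ℝ f x (EuclideanSpace.single j 1) :=
        TestFunction.lineDerivCLM_apply_of_le (𝕜 := ℝ) le_top
      rw [he, ((f.contDiff.differentiable (by simp)) x).lineDeriv_eq_fderiv]
    rw [← h1, ← h2, smul_sub, Finset.mul_sum, Finset.smul_sum, Finset.smul_sum, Finset.sum_smul,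
      Finset.smul_sum]
    congr 1
    · refine Finset.sum_congr rfl fun j _ => ?_
      simp only [real_smul]
      ring
    · refine Finset.sum_congr rfl fun j _ => ?_
      rw [h3]
      simp only [real_smul, smul_eq_mul]
      push_cast
      ring

end

/-! ### The limit of the cutoff: the source as a shell integral -/

theorem deriv_smoothTransition_of_nonpos {w : ℝ} (hw : w ≤ 0) :
    deriv Real.smoothTransition w = 0 :=
  IsLocalMin.deriv_eq_zero (Eventually.of_forall fun v => by
    rw [Real.smoothTransition.zero_of_nonpos hw]; exact Real.smoothTransition.nonneg v)

theorem deriv_smoothTransition_of_one_le {w : ℝ} (hw : 1 ≤ w) :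
    deriv Real.smoothTransition w = 0 :=
  IsLocalMax.deriv_eq_zero (Eventually.of_forall fun v => by
    rw [Real.smoothTransition.one_of_one_le hw]; exact Real.smoothTransition.le_one v)

/-- A smooth approximation of `Θ(s - c)`, with transition region `[c, c + 1 / (n + 1)]`. -/
def cutoff (c : ℝ) (n : ℕ) (s : ℝ) : ℝ := Real.smoothTransition ((n + 1) * (s - c))

theorem contDiff_cutoff (c : ℝ) (n : ℕ) : ContDiff ℝ 1 (cutoff c n) :=
  Real.smoothTransition.contDiff.comp (by fun_prop)

theorem cutoff_eq_zero {c s : ℝ} (n : ℕ) (h : s ≤ c) : cutoff c n s = 0 :=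
  Real.smoothTransition.zero_of_nonpos
    (mul_nonpos_of_nonneg_of_nonpos (by positivity) (sub_nonpos.2 h))

theorem tendsto_cutoff {c s : ℝ} (h : c < s) :
    Tendsto (fun n => cutoff c n s) atTop (𝓝 1) := by
  refine tendsto_const_nhds.congr' ?_
  obtain ⟨N, hN⟩ := exists_nat_gt (1 / (s - c))
  filter_upwards [eventually_ge_atTop N] with n hn
  have hsc := sub_pos.2 h
  refine (Real.smoothTransition.one_of_one_le ?_).symm
  rw [div_lt_iff₀ hsc] at hN
  have : (N : ℝ) ≤ n := by exact_mod_cast hn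
  nlinarith

theorem deriv_cutoff (c : ℝ) (n : ℕ) (s : ℝ) :
    deriv (cutoff c n) s =
      (n + 1) * deriv Real.smoothTransition ((n + 1) * s - (n + 1) * c) := by
  have h1 : HasDerivAt Real.smoothTransition _ (((n : ℝ) + 1) * (s - c)) :=
    ((Real.smoothTransition.contDiff (n := 1)).differentiable one_ne_zero _).hasDerivAt
  have h2 : HasDerivAt (fun s : ℝ => ((n : ℝ) + 1) * (s - c)) (n + 1) s := by
    simpa using ((hasDerivAt_id s).sub_const c).const_mul ((n : ℝ) + 1)
  have h3 : HasDerivAt (cutoff c n) _ s := h1.comp s h2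
  rw [h3.deriv, mul_sub, mul_comm]

/-- The derivatives of the cutoffs are an approximate identity at `c`. -/
theorem tendsto_integral_deriv_cutoff {c : ℝ} (hc : 0 < c) {K : ℝ → ℂ}
    (hK : ContinuousOn K (Icc c (c + 1))) :
    Tendsto (fun n => ∫ s in Ioi 0, deriv (cutoff c n) s • K s) atTop (𝓝 (K c)) := by
  set ψ := deriv Real.smoothTransition with hψ
  have hψc : Continuous ψ := (Real.smoothTransition.contDiff (n := 1)).continuous_deriv le_rfl
  -- rescaling the transition region to the unit interval
  have hscale : ∀ n : ℕ, ∫ s in Ioi 0, deriv (cutoff c n) s • K s =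
      ∫ w in (0 : ℝ)..1, ψ w • K (c + w / (n + 1)) := fun n => by
    have hN : (0 : ℝ) < n + 1 := by positivity
    have h1 : ∫ s in Ioi 0, deriv (cutoff c n) s • K s =
        ∫ s in Ioc c (c + 1 / (n + 1)), deriv (cutoff c n) s • K s := by
      refine setIntegral_eq_of_subset_of_forall_sdiff_eq_zero measurableSet_Ioi
        (fun s hs => hc.trans hs.1) ?_
      rintro s ⟨_, hs⟩
      rw [deriv_cutoff, ← mul_sub]
      rcases le_or_gt s c with hsc | hsc
      · rw [deriv_smoothTransition_of_nonpos
          (mul_nonpos_of_nonneg_of_nonpos hN.le (sub_nonpos.2 hsc))]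
        simp
      · have : c + 1 / ((n : ℝ) + 1) < s := by
          by_contra! hcon; exact hs ⟨hsc, hcon⟩
        rw [deriv_smoothTransition_of_one_le]
        · simp
        · rw [← lt_sub_iff_add_lt', div_lt_iff₀ hN] at this
          linarith
    rw [h1, ← intervalIntegral.integral_of_le (by linarith [one_div_pos.2 hN])]
    have h2 := intervalIntegral.smul_integral_comp_mul_sub (a := c) (b := c + 1 / (n + 1))
      (fun w => ψ w • K (c + w / (n + 1))) ((n : ℝ) + 1) ((n + 1) * c)
    rw [sub_self, show ((n : ℝ) + 1) * (c + 1 / (n + 1)) - (n + 1) * c = 1 by field_simp; ring]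
      at h2
    rw [← h2, ← intervalIntegral.integral_smul]
    refine intervalIntegral.integral_congr fun s _ => ?_
    simp only [deriv_cutoff, ← hψ, smul_smul]
    congr 2
    field_simp
    ring
  simp only [hscale]
  have hone : ∫ w in (0 : ℝ)..1, ψ w • K c = K c := by
    rw [intervalIntegral.integral_smul_const, hψ, intervalIntegral.integral_deriv_eq_sub
      (fun x _ => (Real.smoothTransition.contDiff (n := 1)).differentiable one_ne_zero x)
      (hψc.intervalIntegrable _ _), Real.smoothTransition.one, Real.smoothTransition.zero]
    simp
  obtain ⟨M, hM⟩ := isCompact_Icc.exists_bound_of_continuousOn hK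
  have hmem : ∀ (n : ℕ), ∀ w ∈ Ioc (0 : ℝ) 1, c + w / ((n : ℝ) + 1) ∈ Icc c (c + 1) := by
    intro n w hw
    have hN : (0 : ℝ) < n + 1 := by positivity
    refine ⟨by linarith [div_pos hw.1 hN], ?_⟩
    have : w / ((n : ℝ) + 1) ≤ 1 := by
      rw [div_le_one hN]; linarith [hw.2, (n.cast_nonneg : (0 : ℝ) ≤ n)]
    linarith
  rw [← hone]
  refine intervalIntegral.tendsto_integral_filter_of_dominated_convergence
    (fun w => ‖ψ w‖ * M) ?_ ?_ ?_ ?_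
  · refine Eventually.of_forall fun n => ?_
    rw [uIoc_of_le zero_le_one]
    refine ContinuousOn.aestronglyMeasurable ?_ measurableSet_Ioc
    exact hψc.continuousOn.smul (hK.comp (by fun_prop) (hmem n))
  · refine Eventually.of_forall fun n => Eventually.of_forall fun w hw => ?_
    rw [uIoc_of_le zero_le_one] at hw
    rw [norm_smul]
    exact mul_le_mul_of_nonneg_left (hM _ (hmem n w hw)) (norm_nonneg _)
  · exact (hψc.norm.mul continuous_const).intervalIntegrable _ _
  · refine Eventually.of_forall fun w hw => ?_
    rw [uIoc_of_le zero_le_one] at hw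
    refine Tendsto.smul tendsto_const_nhds ?_
    have h1 : Tendsto (fun n : ℕ => c + w / ((n : ℝ) + 1)) atTop (𝓝[Icc c (c + 1)] c) := by
      refine tendsto_nhdsWithin_iff.2 ⟨?_, Eventually.of_forall fun n => hmem n w hw⟩
      have := (tendsto_one_div_add_atTop_nhds_zero_nat (𝕜 := ℝ)).const_mul w
      simpa [div_eq_mul_inv] using this.const_add c
    exact (hK c ⟨le_rfl, by linarith⟩).tendsto.comp h1

section

variable {y e₁ e₂ : Space} {u ε : ℝ} {g : ℂ → ℂ}

/-- The coordinate vector `∂_p`. -/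
def osDirP (y e₁ e₂ : Space) (p q φ : ℝ) : Space :=
  (q / ‖y‖) • (‖y‖⁻¹ • y) + (osRadius ‖y‖ p q * p / (p ^ 2 + ‖y‖ ^ 2)) • radialDir e₁ e₂ φ

/-- The coordinate vector `∂_q`, away from the axis `q = ± a`. -/
def osDirQ (y e₁ e₂ : Space) (p q φ : ℝ) : Space :=
  (p / ‖y‖) • (‖y‖⁻¹ • y) - (osRadius ‖y‖ p q * q / (‖y‖ ^ 2 - q ^ 2)) • radialDir e₁ e₂ φ

theorem hasFDerivAt_osPoint (hy : y ≠ 0) (e₁ e₂ : Space) (p φ : ℝ) {q : ℝ}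
    (hq : q ∈ Ioo (-‖y‖) ‖y‖) :
    HasFDerivAt (fun v : ℝ × ℝ => osPoint y e₁ e₂ v.1 v.2 φ)
      ((ContinuousLinearMap.fst ℝ ℝ ℝ).smulRight (osDirP y e₁ e₂ p q φ) +
        (ContinuousLinearMap.snd ℝ ℝ ℝ).smulRight (osDirQ y e₁ e₂ p q φ)) (p, q) := by
  have h1 := (((hasFDerivAt_fst (𝕜 := ℝ) (p := (p, q))).mul
    (hasFDerivAt_snd (𝕜 := ℝ) (p := (p, q)))).mul_const ‖y‖⁻¹).smul_const (‖y‖⁻¹ • y)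
  have h2 := (hasFDerivAt_osRadius (p := p) (norm_pos_iff.2 hy) hq).smul_const (radialDir e₁ e₂ φ)
  refine (h1.add h2).congr_fderiv ?_
  ext1
  · ext1
    simp only [osDirP, ContinuousLinearMap.comp_apply, _root_.add_apply, _root_.sub_apply,
      _root_.smul_apply, ContinuousLinearMap.smulRight_apply, ContinuousLinearMap.inl_apply,
      ContinuousLinearMap.coe_fst', ContinuousLinearMap.coe_snd', smul_eq_mul]
    module
  · ext1
    simp only [osDirQ, ContinuousLinearMap.comp_apply, _root_.add_apply, _root_.sub_apply,
      _root_.smul_apply, ContinuousLinearMap.smulRight_apply, ContinuousLinearMap.inr_apply,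
      ContinuousLinearMap.coe_fst', ContinuousLinearMap.coe_snd', smul_eq_mul]
    module

/-- The gradient of `p` is normal to the spheroids: it is a multiple of `∂_p`. -/
theorem gradRe_osPoint (hy : y ≠ 0) (h : Orthonormal ℝ ![e₁, e₂, ‖y‖⁻¹ • y]) {p q : ℝ} (hp : 0 < p)
    (hq : q ∈ Icc (-‖y‖) ‖y‖) (φ : ℝ) :
    gradRe y (osPoint y e₁ e₂ p q φ) =
      ((p ^ 2 + ‖y‖ ^ 2) / (p ^ 2 + q ^ 2)) • osDirP y e₁ e₂ p q φ := by
  have hy' : ‖y‖ ≠ 0 := norm_ne_zero_iff.2 hy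
  have hN : normSq ((p : ℂ) - I * q) = p ^ 2 + q ^ 2 := by
    rw [normSq_apply]; simp; ring
  rw [gradRe, complexDist_osPoint hy h hp hq, hN]
  have hre : ((p : ℂ) - I * q).re = p := by simp
  have him : ((p : ℂ) - I * q).im = -q := by simp
  rw [hre, him, osPoint_eq, osDirP]
  have e1 : (p ^ 2 + ‖y‖ ^ 2) * (q / ‖y‖ * ‖y‖⁻¹) = p * (p * q / ‖y‖ * ‖y‖⁻¹) + q := by
    field_simp
  have e2 : (p ^ 2 + ‖y‖ ^ 2) * (osRadius ‖y‖ p q * p / (p ^ 2 + ‖y‖ ^ 2)) =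
      p * osRadius ‖y‖ p q := by
    field_simp
  rw [show (p ^ 2 + ‖y‖ ^ 2) / (p ^ 2 + q ^ 2) = (p ^ 2 + q ^ 2)⁻¹ * (p ^ 2 + ‖y‖ ^ 2) from
    div_eq_inv_mul _ _, mul_smul]
  congr 1
  have e3 : (p ^ 2 + ‖y‖ ^ 2) • ((q / ‖y‖) • ‖y‖⁻¹ • y +
      (osRadius ‖y‖ p q * p / (p ^ 2 + ‖y‖ ^ 2)) • radialDir e₁ e₂ φ) =
      ((p ^ 2 + ‖y‖ ^ 2) * (q / ‖y‖ * ‖y‖⁻¹)) • y +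
      ((p ^ 2 + ‖y‖ ^ 2) * (osRadius ‖y‖ p q * p / (p ^ 2 + ‖y‖ ^ 2))) • radialDir e₁ e₂ φ := by
    module
  rw [e3, e1, e2]
  module

/-- The density, with respect to `dq dφ`, of the boundary term of Green's identity on the surface
of constant `p`. -/
def boundaryDensity (g : ℂ → ℂ) (y e₁ e₂ : Space) (u t : ℝ) (f : Space → ℝ) (p : ℝ)
    (v : ℝ × ℝ) : ℂ :=
  ((p ^ 2 + ‖y‖ ^ 2) / ‖y‖) •
    (fderiv ℝ f (osPoint y e₁ e₂ p v.1 v.2) (osDirP y e₁ e₂ p v.1 v.2) •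
        profile g u t ((p : ℂ) - I * (v.1 : ℂ)) -
      f (osPoint y e₁ e₂ p v.1 v.2) • profileDeriv g u t ((p : ℂ) - I * (v.1 : ℂ)))

theorem sub_I_mul_mem_halfStrip (hu : ‖y‖ < |u|) {p q : ℝ} (hp : 0 < p)
    (hq : q ∈ Icc (-‖y‖) ‖y‖) : (p : ℂ) - I * (q : ℂ) ∈ halfStrip u := by
  refine ⟨by simpa using hp, ?_⟩
  have : ((p : ℂ) - I * (q : ℂ)).im = -q := by simp
  rw [this, abs_neg]
  exact (abs_le.2 hq).trans_lt hu

theorem flux_osPoint (hy : y ≠ 0) (hu : ‖y‖ < |u|) (h : Orthonormal ℝ ![e₁, e₂, ‖y‖⁻¹ • y])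
    (t : ℝ) (f : Space → ℝ) {p q : ℝ} (hp : 0 < p) (hq : q ∈ Icc (-‖y‖) ‖y‖) (φ : ℝ) :
    ((p ^ 2 + q ^ 2) / ‖y‖) • flux g y u t f (osPoint y e₁ e₂ p q φ) =
      -boundaryDensity g y e₁ e₂ u t f p (q, φ) := by
  have hR := complexDist_osPoint hy h hp hq φ
  have hz := ne_zero_of_mem_halfStrip (sub_I_mul_mem_halfStrip hu hp hq)
  have hN : normSq ((p : ℂ) - I * q) = p ^ 2 + q ^ 2 := by
    rw [normSq_apply]; simp; ring
  have hre : ((p : ℂ) - I * q).re = p := by simp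
  have hpq : p ^ 2 + q ^ 2 ≠ 0 := by positivity
  have hpq' : (p : ℂ) ^ 2 + (q : ℂ) ^ 2 ≠ 0 := by exact_mod_cast hpq
  have hy' : (‖y‖ : ℂ) ≠ 0 := by exact_mod_cast norm_ne_zero_iff.2 hy
  rw [flux, sepForm_gradRe (by rw [hR, hre]; exact hp), gradRe_osPoint hy h hp hq, hR, hN, hre,
    boundaryDensity]
  generalize (p : ℂ) - I * q = z at hz ⊢
  simp only [map_smul, real_smul, smul_eq_mul]
  push_cast
  field_simp
  ring

theorem continuousOn_boundaryDensity (hu : ‖y‖ < |u|) (e₁ e₂ : Space)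
    (hg : DifferentiableOn ℂ g {τ | τ.im ≠ 0}) (t : ℝ)
    (f : 𝓓((⊤ : TopologicalSpace.Opens Space), ℝ)) (hy : y ≠ 0) :
    ContinuousOn (fun w : ℝ × ℝ × ℝ => boundaryDensity g y e₁ e₂ u t f w.1 w.2)
      (Ioi 0 ×ˢ (Icc (-‖y‖) ‖y‖ ×ˢ univ)) := by
  have hf' : Continuous (fderiv ℝ f) := f.contDiff.continuous_fderiv (by simp)
  have hP := continuous_osPoint y e₁ e₂
  have hρ : Continuous fun w : ℝ × ℝ × ℝ => osRadius ‖y‖ w.1 w.2.1 :=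
    (continuous_osRadius ‖y‖).comp (by fun_prop : Continuous fun w : ℝ × ℝ × ℝ => (w.1, w.2.1))
  have hD : Continuous fun w : ℝ × ℝ × ℝ => osDirP y e₁ e₂ w.1 w.2.1 w.2.2 := by
    unfold osDirP radialDir
    have : ∀ w : ℝ × ℝ × ℝ, w.1 ^ 2 + ‖y‖ ^ 2 ≠ 0 := fun w => by
      have := norm_pos_iff.2 hy; positivity
    fun_prop (disch := assumption)
  have hz : ∀ w ∈ Ioi (0 : ℝ) ×ˢ (Icc (-‖y‖) ‖y‖ ×ˢ (univ : Set ℝ)),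
      (w.1 : ℂ) - I * (w.2.1 : ℂ) ∈ halfStrip u := fun w hw =>
    sub_I_mul_mem_halfStrip hu hw.1 hw.2.1
  have hzc : Continuous fun w : ℝ × ℝ × ℝ => (w.1 : ℂ) - I * (w.2.1 : ℂ) := by fun_prop
  have h1 : Continuous fun w : ℝ × ℝ × ℝ => fderiv ℝ f (osPoint y e₁ e₂ w.1 w.2.1 w.2.2)
      (osDirP y e₁ e₂ w.1 w.2.1 w.2.2) := (hf'.comp hP).clm_apply hD
  have h2 : Continuous fun w : ℝ × ℝ × ℝ => f (osPoint y e₁ e₂ w.1 w.2.1 w.2.2) :=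
    f.continuous.comp hP
  have h3 : ContinuousOn (fun w : ℝ × ℝ × ℝ => profile g u t ((w.1 : ℂ) - I * (w.2.1 : ℂ)))
      (Ioi 0 ×ˢ (Icc (-‖y‖) ‖y‖ ×ˢ univ)) := fun w hw =>
    (ContinuousAt.comp (f := fun w : ℝ × ℝ × ℝ => (w.1 : ℂ) - I * (w.2.1 : ℂ))
      (continuousAt_profile hg t (hz w hw)) hzc.continuousAt).continuousWithinAt
  have h4 : ContinuousOn (fun w : ℝ × ℝ × ℝ => profileDeriv g u t ((w.1 : ℂ) - I * (w.2.1 : ℂ)))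
      (Ioi 0 ×ˢ (Icc (-‖y‖) ‖y‖ ×ˢ univ)) := fun w hw =>
    (ContinuousAt.comp (f := fun w : ℝ × ℝ × ℝ => (w.1 : ℂ) - I * (w.2.1 : ℂ))
      (continuousAt_profileDeriv hg t (hz w hw)) hzc.continuousAt).continuousWithinAt
  have h5 : Continuous fun w : ℝ × ℝ × ℝ => (w.1 ^ 2 + ‖y‖ ^ 2) / ‖y‖ := by fun_prop
  exact h5.continuousOn.smul ((h1.continuousOn.smul h3).sub (h2.continuousOn.smul h4))

theorem measurableSet_osRange (a : ℝ) : MeasurableSet (osRange a) :=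
  measurableSet_Ioo.prod measurableSet_Ioo

theorem volume_osRange_lt_top (a : ℝ) : volume (osRange a) < ⊤ := by
  rw [osRange, Measure.volume_eq_prod, Measure.prod_prod]
  exact ENNReal.mul_lt_top measure_Ioo_lt_top measure_Ioo_lt_top

/-- The integral over the coordinate range of a surface depends continuously on the surface. -/
theorem continuousOn_setIntegral_osRange {a c : ℝ} (hc : 0 < c) {L : ℝ × ℝ × ℝ → ℂ}
    (hL : ContinuousOn L (Ioi 0 ×ˢ (Icc (-a) a ×ˢ univ))) :
    ContinuousOn (fun p => ∫ v in osRange a, L (p, v)) (Icc c (c + 1)) := by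
  have hK : IsCompact (Icc c (c + 1) ×ˢ (Icc (-a) a ×ˢ Icc 0 (2 * Real.pi))) :=
    isCompact_Icc.prod (isCompact_Icc.prod isCompact_Icc)
  obtain ⟨M, hM⟩ := hK.exists_bound_of_continuousOn
    (hL.mono fun w hw => ⟨hc.trans_le hw.1.1, hw.2.1, trivial⟩)
  have hfin : IsFiniteMeasure (volume.restrict (osRange a)) :=
    ⟨by rw [Measure.restrict_apply_univ]; exact volume_osRange_lt_top _⟩
  refine continuousOn_of_dominated (bound := fun _ => M) (fun p hp => ?_) (fun p hp => ?_)
    (integrable_const M) ?_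
  · refine ContinuousOn.aestronglyMeasurable ?_ (measurableSet_osRange _)
    exact hL.comp (by fun_prop : Continuous fun v : ℝ × ℝ => (p, v)).continuousOn
      fun v hv => ⟨hc.trans_le hp.1, Ioo_subset_Icc_self hv.1, trivial⟩
  · exact (ae_restrict_iff' (measurableSet_osRange _)).2 (Eventually.of_forall fun v hv =>
      hM (p, v) ⟨hp, Ioo_subset_Icc_self hv.1, Ioo_subset_Icc_self hv.2⟩)
  · refine (ae_restrict_iff' (measurableSet_osRange _)).2 (Eventually.of_forall fun v hv => ?_)
    exact hL.comp (by fun_prop : Continuous fun p : ℝ => (p, v)).continuousOn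
      fun p hp => ⟨hc.trans_le hp.1, Ioo_subset_Icc_self hv.1, trivial⟩

/-- The flux through the transition region in oblate spheroidal coordinates. -/
theorem integral_flux_eq (hy : y ≠ 0) (hu : ‖y‖ < |u|) (h : Orthonormal ℝ ![e₁, e₂, ‖y‖⁻¹ • y])
    (hg : DifferentiableOn ℂ g {τ | τ.im ≠ 0}) (t : ℝ) {c : ℝ} (hc : 0 < c) {χ : ℝ → ℝ}
    (hχ : ContDiff ℝ 1 χ) (hχ0 : ∀ s < c, χ s = 0)
    (f : 𝓓((⊤ : TopologicalSpace.Opens Space), ℝ)) :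
    ∫ x, deriv χ (complexDist y x).re • flux g y u t f x =
      -∫ p in Ioi 0, deriv χ p • ∫ v in osRange ‖y‖, boundaryDensity g y e₁ e₂ u t f p v := by
  have hχ' := hχ.continuous_deriv le_rfl
  have hχ'0 := deriv_eq_zero_of_lt hχ0
  have hsupp : HasCompactSupport fun x => deriv χ (complexDist y x).re • flux g y u t f x := by
    refine HasCompactSupport.intro f.hasCompactSupport fun x hx => ?_
    have h1 : fderiv ℝ f x = 0 :=
      Function.notMem_support.1 fun hx' => hx (support_fderiv_subset ℝ hx')
    simp [flux, h1, image_eq_zero_of_notMem_tsupport hx]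
  have hcont : Continuous fun x => deriv χ (complexDist y x).re • flux g y u t f x :=
    continuous_cutoff hc hχ' hχ'0 fun x hx => continuousAt_flux hy hu hg t f hx
  have hint := hcont.integrable_of_hasCompactSupport (μ := volume) hsupp
  have hset : ∫ x, deriv χ (complexDist y x).re • flux g y u t f x =
      ∫ x in {x | 0 < (complexDist y x).re}, deriv χ (complexDist y x).re • flux g y u t f x := by
    refine (setIntegral_eq_integral_of_forall_compl_eq_zero fun x hx => ?_).symm
    rw [hχ'0 _ ((not_lt.1 hx).trans_lt hc), zero_smul]
  obtain ⟨h1, h2⟩ := integral_osPoint hy h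
    fun x => deriv χ (complexDist y x).re • flux g y u t f x
  have hcongr : ∀ w ∈ Ioi 0 ×ˢ osRange ‖y‖, ((w.1 ^ 2 + w.2.1 ^ 2) / ‖y‖) •
      (deriv χ (complexDist y (osPoint y e₁ e₂ w.1 w.2.1 w.2.2)).re •
        flux g y u t f (osPoint y e₁ e₂ w.1 w.2.1 w.2.2)) =
      -(deriv χ w.1 • boundaryDensity g y e₁ e₂ u t f w.1 w.2) := fun w hw => by
    have hq := Ioo_subset_Icc_self hw.2.1
    have hre : ((w.1 : ℂ) - I * (w.2.1 : ℂ)).re = w.1 := by simp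
    rw [smul_comm, flux_osPoint hy hu h t f hw.1 hq, complexDist_osPoint hy h hw.1 hq, hre,
      smul_neg]
  have hmeas : MeasurableSet (Ioi (0 : ℝ) ×ˢ osRange ‖y‖) :=
    measurableSet_Ioi.prod (measurableSet_osRange _)
  have hI := (integrableOn_congr_fun hcongr hmeas).1 (h2.1 hint.integrableOn)
  rw [hset, h1, setIntegral_congr_fun hmeas hcongr, Measure.volume_eq_prod, setIntegral_prod _ hI,
    ← integral_neg]
  refine integral_congr_ae (Eventually.of_forall fun p => ?_)
  simp only
  rw [integral_neg, integral_smul]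

/-- The source at time `t` is the boundary term of Green's identity on the spheroid. -/
theorem sourceAt_eq_integral_boundaryDensity (hy : y ≠ 0) (hu : ‖y‖ < |u|) (hε : 0 < ε)
    (h : Orthonormal ℝ ![e₁, e₂, ‖y‖⁻¹ • y])
    (hg : DifferentiableOn ℂ g {τ | τ.im ≠ 0}) (t : ℝ)
    (f : 𝓓((⊤ : TopologicalSpace.Opens Space), ℝ)) :
    sourceAt g y u ε t f =
      ∫ v in osRange ‖y‖, boundaryDensity g y e₁ e₂ u t f (ε * ‖y‖) v := by
  have hc : 0 < ε * ‖y‖ := mul_pos hε (norm_pos_iff.2 hy)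
  set c := ε * ‖y‖ with hcdef
  have hlim : ∀ {g : ℂ → ℂ}, DifferentiableOn ℂ g {τ | τ.im ≠ 0} →
      ∀ f : 𝓓((⊤ : TopologicalSpace.Opens Space), ℝ),
      Tendsto (fun n => ∫ x, f x • (cutoff c n (complexDist y x).re •
        profile g u t (complexDist y x))) atTop
        (𝓝 (∫ x, f x • shieldedBeam g y u ε (x, t))) := by
    intro g hg f
    have hli := locallyIntegrable_shieldedBeam_slice hy hu hε hg t
    refine tendsto_integral_of_dominated_convergence
      (fun x => ‖f x • shieldedBeam g y u ε (x, t)‖) (fun n => ?_)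
      (integrable_smul_testFunction hli f).norm (fun n => Eventually.of_forall fun x => ?_)
      (Eventually.of_forall fun x => ?_)
    · refine (integrable_of_continuous_smul (continuous_cutoff hc (contDiff_cutoff c n).continuous
        (fun s hs => cutoff_eq_zero n hs.le) fun x hx => ?_) f).aestronglyMeasurable
      exact (continuousAt_profile hg t (complexDist_mem_halfStrip hy hu hx)).comp
        (continuousAt_complexDist hx)
    · rw [norm_smul, norm_smul (f x)]
      refine mul_le_mul_of_nonneg_left ?_ (norm_nonneg (f x))
      by_cases hx : c < (complexDist y x).re
      · simp only [shieldedBeam, ← hcdef, hx, if_true, beam_eq, norm_smul]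
        refine mul_le_of_le_one_left (norm_nonneg _) ?_
        rw [cutoff, Real.norm_of_nonneg (Real.smoothTransition.nonneg _)]
        exact Real.smoothTransition.le_one _
      · rw [cutoff_eq_zero n (not_lt.1 hx), zero_smul, norm_zero]
        exact norm_nonneg _
    · refine Tendsto.const_smul ?_ (f x)
      by_cases hx : c < (complexDist y x).re
      · simp only [shieldedBeam, ← hcdef, hx, if_true, beam_eq]
        simpa using (tendsto_cutoff hx).smul_const (profile g u t (complexDist y x))
      · simp only [shieldedBeam, ← hcdef, hx, if_false]
        simp [cutoff_eq_zero _ (not_lt.1 hx)]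
  have l1 := hlim (differentiableOn_deriv (differentiableOn_deriv hg)) f
  have l2 := hlim hg (laplace f)
  have l3 := tendsto_integral_deriv_cutoff hc
    (continuousOn_setIntegral_osRange hc (continuousOn_boundaryDensity hu e₁ e₂ hg t f hy))
  rw [sourceAt_apply hy hu hε hg]
  -- both sides are limits of the terms of Green's identity for the cut off beam
  refine tendsto_nhds_unique (l1.sub l2) (l3.congr fun n => ?_)
  rw [green_cutoff hy hu hg t hc (contDiff_cutoff c n) (fun s hs => cutoff_eq_zero n hs.le) f,
    integral_flux_eq hy hu h hg t hc (contDiff_cutoff c n) (fun s hs => cutoff_eq_zero n hs.le) f]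
  ring

end

/-! ### The azimuthal mean and the two source formulas -/

/-- The partial derivatives combine to `∂_p + i ∂_q` at a point of differentiability. -/
theorem dPQ_eq_of_hasFDerivAt {H : ℝ → ℝ → ℝ} {L : ℝ × ℝ →L[ℝ] ℝ} {p q : ℝ}
    (h : HasFDerivAt (fun v : ℝ × ℝ => H v.1 v.2) L (p, q)) :
    dPQ H p q = (L (1, 0) : ℂ) + I * (L (0, 1) : ℂ) := by
  have h1 : HasDerivAt (fun p' => H p' q) (L (1, 0)) p :=
    HasFDerivAt.comp_hasDerivAt (f := fun p' => (p', q)) (l := fun v : ℝ × ℝ => H v.1 v.2) p h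
      ((hasDerivAt_id p).prodMk (hasDerivAt_const p q))
  have h2 : HasDerivAt (fun q' => H p q') (L (0, 1)) q :=
    HasFDerivAt.comp_hasDerivAt (f := fun q' => (p, q')) (l := fun v : ℝ × ℝ => H v.1 v.2) q h
      ((hasDerivAt_const q p).prodMk (hasDerivAt_id q))
  rw [dPQ, h1.ofReal_comp.deriv, h2.ofReal_comp.deriv]

/-- The inverse square root singularity of `∂_q ρ` at the poles is integrable. -/
theorem integrableOn_osRadius_div {a : ℝ} (ha : 0 < a) (p : ℝ) :
    IntegrableOn (fun q => osRadius a p q / (a ^ 2 - q ^ 2)) (Ioo (-a) a) := by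
  set C := Real.sqrt (p ^ 2 + a ^ 2) / a
  -- the function is a multiple of `1 / √(a² - q²)`, with antiderivative the arcsine
  have hd : ∀ q ∈ Ioo (-a) a, HasDerivAt (fun q => C * Real.arcsin (q / a))
      (osRadius a p q / (a ^ 2 - q ^ 2)) q := fun q hq => by
    have h1 : q / a ≠ -1 := fun h => by
      rw [div_eq_iff ha.ne'] at h; linarith [hq.1]
    have h2 : q / a ≠ 1 := fun h => by
      rw [div_eq_iff ha.ne'] at h; linarith [hq.2]
    have hB := sq_sub_sq_pos hq
    have hr := Real.sqrt_pos.2 hB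
    have hrr := Real.sq_sqrt hB.le
    refine (((Real.hasDerivAt_arcsin h1 h2).comp q
      ((hasDerivAt_id q).div_const a)).const_mul C).congr_deriv ?_
    have e1 : 1 - (q / a) ^ 2 = (a ^ 2 - q ^ 2) / a ^ 2 := by field_simp
    rw [e1, Real.sqrt_div' _ (by positivity), Real.sqrt_sq ha.le, osRadius,
      Real.sqrt_mul (by positivity)]
    rw [show a ^ 2 - q ^ 2 = Real.sqrt (a ^ 2 - q ^ 2) ^ 2 from hrr.symm, Real.sqrt_sq hr.le]
    field_simp
    exact div_mul_cancel₀ _ ha.ne'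
  refine (intervalIntegral.integrableOn_deriv_of_nonneg (g := fun q => C * Real.arcsin (q / a))
    (by fun_prop) hd fun q hq => ?_).mono_set Ioo_subset_Ioc_self
  exact (div_pos (osRadius_pos ha hq) (sq_sub_sq_pos hq)).le

theorem restrict_osRange (a : ℝ) : (volume : Measure (ℝ × ℝ)).restrict (osRange a) =
    (volume.restrict (Ioo (-a) a)).prod (volume.restrict (Ioo 0 (2 * Real.pi))) := by
  rw [osRange, Measure.prod_restrict, Measure.volume_eq_prod]

theorem integrableOn_osRange_of_continuousOn {a : ℝ} {F : ℝ × ℝ → ℂ}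
    (hF : ContinuousOn F (Icc (-a) a ×ˢ univ)) : IntegrableOn F (osRange a) :=
  ((hF.mono (prod_mono_right (subset_univ (Icc 0 (2 * Real.pi))))).integrableOn_compact
    (isCompact_Icc.prod isCompact_Icc)).mono_set
    (prod_mono Ioo_subset_Icc_self Ioo_subset_Icc_self)

/-- A continuous function times an integrable function of `q` is integrable over the shell. -/
theorem integrableOn_osRange_mul {a : ℝ} {F : ℝ × ℝ → ℂ} {w : ℝ → ℂ}
    (hF : ContinuousOn F (Icc (-a) a ×ˢ univ)) (hw : IntegrableOn w (Ioo (-a) a)) :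
    IntegrableOn (fun v => F v * w v.1) (osRange a) := by
  have h1 : IntegrableOn (fun v : ℝ × ℝ => w v.1) (osRange a) := by
    rw [IntegrableOn, restrict_osRange]
    exact Integrable.comp_fst hw _
  obtain ⟨M, hM⟩ := (isCompact_Icc.prod isCompact_Icc).exists_bound_of_continuousOn
    (hF.mono (prod_mono_right (subset_univ (Icc 0 (2 * Real.pi)))))
  refine h1.bdd_mul (c := M) ?_ ?_
  · exact (hF.mono fun v hv => ⟨Ioo_subset_Icc_self hv.1, trivial⟩).aestronglyMeasurable
      (measurableSet_osRange a)
  · exact (ae_restrict_iff' (measurableSet_osRange a)).2 (Eventually.of_forall fun v hv =>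
      hM v ⟨Ioo_subset_Icc_self hv.1, Ioo_subset_Icc_self hv.2⟩)

section

variable {y e₁ e₂ : Space} {u ε : ℝ} {g : ℂ → ℂ}

theorem hasFDerivAt_comp_osPoint (hy : y ≠ 0) (e₁ e₂ : Space)
    (f : 𝓓((⊤ : TopologicalSpace.Opens Space), ℝ)) (p φ : ℝ) {q : ℝ}
    (hq : q ∈ Ioo (-‖y‖) ‖y‖) :
    HasFDerivAt (fun v : ℝ × ℝ => f (osPoint y e₁ e₂ v.1 v.2 φ))
      (fderiv ℝ f (osPoint y e₁ e₂ p q φ) ∘L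
        ((ContinuousLinearMap.fst ℝ ℝ ℝ).smulRight (osDirP y e₁ e₂ p q φ) +
        (ContinuousLinearMap.snd ℝ ℝ ℝ).smulRight (osDirQ y e₁ e₂ p q φ))) (p, q) :=
  HasFDerivAt.comp (g := f) (f := fun v : ℝ × ℝ => osPoint y e₁ e₂ v.1 v.2 φ) (p, q)
    ((f.contDiff.differentiable (by simp)) _).hasFDerivAt (hasFDerivAt_osPoint hy e₁ e₂ p φ hq)

theorem dPQ_comp_osPoint (hy : y ≠ 0) (e₁ e₂ : Space)
    (f : 𝓓((⊤ : TopologicalSpace.Opens Space), ℝ)) (p φ : ℝ) {q : ℝ}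
    (hq : q ∈ Ioo (-‖y‖) ‖y‖) :
    dPQ (fun p' q' => f (osPoint y e₁ e₂ p' q' φ)) p q =
      (fderiv ℝ f (osPoint y e₁ e₂ p q φ) (osDirP y e₁ e₂ p q φ) : ℂ) +
        I * (fderiv ℝ f (osPoint y e₁ e₂ p q φ) (osDirQ y e₁ e₂ p q φ) : ℂ) := by
  rw [dPQ_eq_of_hasFDerivAt (hasFDerivAt_comp_osPoint hy e₁ e₂ f p φ hq)]
  simp

theorem continuous_radialDir (e₁ e₂ : Space) : Continuous (radialDir e₁ e₂) := by
  unfold radialDir; fun_prop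

theorem continuous_osPoint_shell (y e₁ e₂ : Space) (p : ℝ) :
    Continuous fun v : ℝ × ℝ => osPoint y e₁ e₂ p v.1 v.2 :=
  (continuous_osPoint y e₁ e₂).comp (by fun_prop : Continuous fun v : ℝ × ℝ => (p, v.1, v.2))

theorem continuous_osDirP_shell (y e₁ e₂ : Space) (p : ℝ) :
    Continuous fun v : ℝ × ℝ => osDirP y e₁ e₂ p v.1 v.2 := by
  have h1 : Continuous fun v : ℝ × ℝ => osRadius ‖y‖ p v.1 :=
    (continuous_osRadius ‖y‖).comp (by fun_prop : Continuous fun v : ℝ × ℝ => (p, v.1))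
  have h2 : Continuous fun v : ℝ × ℝ => radialDir e₁ e₂ v.2 :=
    (continuous_radialDir e₁ e₂).comp continuous_snd
  unfold osDirP
  fun_prop

theorem continuous_fderiv_shell (y e₁ e₂ : Space)
    (f : 𝓓((⊤ : TopologicalSpace.Opens Space), ℝ)) (p : ℝ) {D : ℝ × ℝ → Space}
    (hD : Continuous D) :
    Continuous fun v : ℝ × ℝ => fderiv ℝ f (osPoint y e₁ e₂ p v.1 v.2) (D v) :=
  ((f.contDiff.continuous_fderiv (by simp)).comp
    (continuous_osPoint_shell y e₁ e₂ p)).clm_apply hD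

theorem integrableOn_fderiv_osDirQ (hy : y ≠ 0) (e₁ e₂ : Space)
    (f : 𝓓((⊤ : TopologicalSpace.Opens Space), ℝ)) (p : ℝ) :
    IntegrableOn (fun v : ℝ × ℝ => (fderiv ℝ f (osPoint y e₁ e₂ p v.1 v.2)
      (osDirQ y e₁ e₂ p v.1 v.2) : ℂ)) (osRange ‖y‖) := by
  have h1 : Continuous fun v : ℝ × ℝ => (fderiv ℝ f (osPoint y e₁ e₂ p v.1 v.2)
      ((p / ‖y‖) • (‖y‖⁻¹ • y)) : ℂ) :=
    continuous_ofReal.comp (continuous_fderiv_shell y e₁ e₂ f p continuous_const)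
  have h2 : Continuous fun v : ℝ × ℝ => ((fderiv ℝ f (osPoint y e₁ e₂ p v.1 v.2)
      (radialDir e₁ e₂ v.2) * v.1 : ℝ) : ℂ) :=
    continuous_ofReal.comp ((continuous_fderiv_shell y e₁ e₂ f p
      ((continuous_radialDir e₁ e₂).comp continuous_snd)).mul continuous_fst)
  have hw : IntegrableOn (fun q => ((osRadius ‖y‖ p q / (‖y‖ ^ 2 - q ^ 2) : ℝ) : ℂ))
      (Ioo (-‖y‖) ‖y‖) := (integrableOn_osRadius_div (norm_pos_iff.2 hy) p).ofReal
  refine ((integrableOn_osRange_of_continuousOn h1.continuousOn).sub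
    (integrableOn_osRange_mul h2.continuousOn hw)).congr_fun (fun v _ => ?_)
    (measurableSet_osRange _)
  simp only [Pi.sub_apply, osDirQ, map_sub, map_smul, smul_eq_mul]
  push_cast
  ring

theorem integrableOn_dPQ (hy : y ≠ 0) (e₁ e₂ : Space)
    (f : 𝓓((⊤ : TopologicalSpace.Opens Space), ℝ)) (p : ℝ) :
    IntegrableOn (fun v : ℝ × ℝ => dPQ (fun p' q' => f (osPoint y e₁ e₂ p' q' v.2)) p v.1)
      (osRange ‖y‖) := by
  have h1 : Continuous fun v : ℝ × ℝ => (fderiv ℝ f (osPoint y e₁ e₂ p v.1 v.2)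
      (osDirP y e₁ e₂ p v.1 v.2) : ℂ) :=
    continuous_ofReal.comp (continuous_fderiv_shell y e₁ e₂ f p
      (continuous_osDirP_shell y e₁ e₂ p))
  refine ((integrableOn_osRange_of_continuousOn h1.continuousOn).add
    ((integrableOn_fderiv_osDirQ hy e₁ e₂ f p).const_mul I)).congr_fun (fun v hv => ?_)
    (measurableSet_osRange _)
  simp only [Pi.add_apply]
  rw [dPQ_comp_osPoint hy e₁ e₂ f p v.2 hv.1]

theorem continuousOn_profile_shell (hu : ‖y‖ < |u|) (hg : DifferentiableOn ℂ g {τ | τ.im ≠ 0})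
    (t : ℝ) {p : ℝ} (hp : 0 < p) :
    ContinuousOn (fun q : ℝ => profile g u t ((p : ℂ) - I * (q : ℂ))) (Icc (-‖y‖) ‖y‖) :=
  fun q hq => (ContinuousAt.comp (f := fun q : ℝ => (p : ℂ) - I * (q : ℂ))
    (continuousAt_profile hg t (sub_I_mul_mem_halfStrip hu hp hq))
    (by fun_prop)).continuousWithinAt

/-- The Cauchy–Riemann equations turn the normal derivative of the beam into a tangential one, and
an integration by parts in `q` moves it to the test function, leaving the values at the poles. -/
theorem integral_boundaryDensity_eq (hy : y ≠ 0) (hu : ‖y‖ < |u|) (e₁ e₂ : Space)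
    (hg : DifferentiableOn ℂ g {τ | τ.im ≠ 0}) (t : ℝ) {p : ℝ} (hp : 0 < p)
    (f : 𝓓((⊤ : TopologicalSpace.Opens Space), ℝ)) :
    IntegrableOn (fun v : ℝ × ℝ => profile g u t ((p : ℂ) - I * (v.1 : ℂ)) *
      dPQ (fun p' q' => f (osPoint y e₁ e₂ p' q' v.2)) p v.1) (osRange ‖y‖) ∧
    ∫ v in osRange ‖y‖, boundaryDensity g y e₁ e₂ u t f p v =
      (((p ^ 2 + ‖y‖ ^ 2) / ‖y‖ : ℝ) : ℂ) *
        ((∫ v in osRange ‖y‖, profile g u t ((p : ℂ) - I * (v.1 : ℂ)) *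
          dPQ (fun p' q' => f (osPoint y e₁ e₂ p' q' v.2)) p v.1) -
        I * (profile g u t ((p : ℂ) - I * (‖y‖ : ℂ)) *
            (∫ φ in (0 : ℝ)..(2 * Real.pi), f (osPoint y e₁ e₂ p ‖y‖ φ) : ℝ) -
          profile g u t ((p : ℂ) + I * (‖y‖ : ℂ)) *
            (∫ φ in (0 : ℝ)..(2 * Real.pi), f (osPoint y e₁ e₂ p (-‖y‖) φ) : ℝ))) := by
  have hy' : 0 < ‖y‖ := norm_pos_iff.2 hy
  have hh := continuousOn_profile_shell hu hg t hp
  have hh' : ContinuousOn (fun v : ℝ × ℝ => profile g u t ((p : ℂ) - I * (v.1 : ℂ)))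
      (Icc (-‖y‖) ‖y‖ ×ˢ univ) := hh.comp continuousOn_fst fun v hv => hv.1
  have hint : ∀ {D : ℝ × ℝ → ℂ}, IntegrableOn D (osRange ‖y‖) →
      IntegrableOn (fun v : ℝ × ℝ => profile g u t ((p : ℂ) - I * (v.1 : ℂ)) * D v)
        (osRange ‖y‖) := by
    intro D hD
    obtain ⟨M, hM⟩ := isCompact_Icc.exists_bound_of_continuousOn hh
    refine hD.bdd_mul (c := M) ?_ ?_
    · exact (hh'.mono fun v hv => ⟨Ioo_subset_Icc_self hv.1, trivial⟩).aestronglyMeasurable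
        (measurableSet_osRange _)
    · exact (ae_restrict_iff' (measurableSet_osRange _)).2 (Eventually.of_forall fun v hv =>
        hM v.1 (Ioo_subset_Icc_self hv.1))
  have i1 := hint (integrableOn_dPQ hy e₁ e₂ f p)
  refine ⟨i1, ?_⟩
  -- `F` is `f W` up to a constant on the shell, and `F'` its derivative in `q`
  set F : ℝ × ℝ → ℂ := fun v =>
    (f (osPoint y e₁ e₂ p v.1 v.2) : ℂ) * profile g u t ((p : ℂ) - I * (v.1 : ℂ)) with hF
  set F' : ℝ × ℝ → ℂ := fun v =>
    (fderiv ℝ f (osPoint y e₁ e₂ p v.1 v.2) (osDirQ y e₁ e₂ p v.1 v.2) : ℂ) *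
      profile g u t ((p : ℂ) - I * (v.1 : ℂ)) +
    (f (osPoint y e₁ e₂ p v.1 v.2) : ℂ) *
      (profileDeriv g u t ((p : ℂ) - I * (v.1 : ℂ)) * (-I)) with hF'
  have hfc : Continuous fun v : ℝ × ℝ => (f (osPoint y e₁ e₂ p v.1 v.2) : ℂ) :=
    continuous_ofReal.comp (f.continuous.comp (continuous_osPoint_shell y e₁ e₂ p))
  have hFc : ContinuousOn F (Icc (-‖y‖) ‖y‖ ×ˢ univ) := hfc.continuousOn.mul hh'
  have i2 : IntegrableOn F' (osRange ‖y‖) := by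
    refine IntegrableOn.add ?_ (integrableOn_osRange_of_continuousOn
      (hfc.continuousOn.mul (ContinuousOn.mul ?_ continuousOn_const)))
    · exact (hint (integrableOn_fderiv_osDirQ hy e₁ e₂ f p)).congr_fun
        (fun v _ => mul_comm _ _) (measurableSet_osRange _)
    · exact fun v hv => (ContinuousAt.comp (f := fun v : ℝ × ℝ => (p : ℂ) - I * (v.1 : ℂ))
        (continuousAt_profileDeriv hg t (sub_I_mul_mem_halfStrip hu hp hv.1))
        (by fun_prop)).continuousWithinAt
  have hpt : ∀ v ∈ osRange ‖y‖, boundaryDensity g y e₁ e₂ u t f p v =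
      (((p ^ 2 + ‖y‖ ^ 2) / ‖y‖ : ℝ) : ℂ) * (profile g u t ((p : ℂ) - I * (v.1 : ℂ)) *
        dPQ (fun p' q' => f (osPoint y e₁ e₂ p' q' v.2)) p v.1 - I * F' v) := fun v hv => by
    rw [boundaryDensity, dPQ_comp_osPoint hy e₁ e₂ f p v.2 hv.1, hF']
    simp only [real_smul]
    linear_combination (((p ^ 2 + ‖y‖ ^ 2) / ‖y‖ : ℝ) : ℂ) *
      (f (osPoint y e₁ e₂ p v.1 v.2) : ℂ) * profileDeriv g u t ((p : ℂ) - I * (v.1 : ℂ)) *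
      (-1) * I_sq
  rw [setIntegral_congr_fun (measurableSet_osRange _) hpt, integral_const_mul,
    integral_sub i1 (i2.const_mul I), integral_const_mul]
  congr 3
  -- integration by parts in `q` for almost every azimuth
  rw [IntegrableOn, restrict_osRange] at i2
  rw [restrict_osRange, integral_prod_symm _ i2]
  have hder : ∀ φ : ℝ, ∀ q ∈ Ioo (-‖y‖) ‖y‖, HasDerivAt (fun q => F (q, φ)) (F' (q, φ)) q := by
    intro φ q hq
    have h1 : HasDerivAt (fun q => f (osPoint y e₁ e₂ p q φ))
        (fderiv ℝ f (osPoint y e₁ e₂ p q φ) (osDirQ y e₁ e₂ p q φ)) q := by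
      have := (hasFDerivAt_comp_osPoint hy e₁ e₂ f p φ hq).comp_hasDerivAt q
        ((hasDerivAt_const q p).prodMk (hasDerivAt_id q))
      simpa [Function.comp_def] using this
    have h2 : HasDerivAt (fun q : ℝ => (p : ℂ) - I * (q : ℂ)) (-I) q := by
      simpa using ((hasDerivAt_id q).ofReal_comp.const_mul I).const_sub (p : ℂ)
    have h3 : HasDerivAt (fun q : ℝ => profile g u t ((p : ℂ) - I * (q : ℂ)))
        (profileDeriv g u t ((p : ℂ) - I * (q : ℂ)) * (-I)) q :=
      HasDerivAt.comp (h₂ := profile g u t) (h := fun q : ℝ => (p : ℂ) - I * (q : ℂ)) q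
        (hasDerivAt_profile hg t (sub_I_mul_mem_halfStrip hu hp (Ioo_subset_Icc_self hq))) h2
    exact h1.ofReal_comp.mul h3
  have hFTC : ∀ᵐ φ ∂(volume.restrict (Ioo 0 (2 * Real.pi))),
      ∫ q in Ioo (-‖y‖) ‖y‖, F' (q, φ) = F (‖y‖, φ) - F (-‖y‖, φ) := by
    filter_upwards [i2.prod_left_ae] with φ hφ
    have hle : -‖y‖ ≤ ‖y‖ := by linarith
    rw [← integral_Ioc_eq_integral_Ioo, ← intervalIntegral.integral_of_le hle]
    refine intervalIntegral.integral_eq_sub_of_hasDerivAt_of_le (f := fun q => F (q, φ)) hle ?_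
      (hder φ) ((intervalIntegrable_iff_integrableOn_Ioo_of_le hle).2 hφ)
    exact hFc.comp (by fun_prop) fun q hq => ⟨hq, trivial⟩
  rw [integral_congr_ae hFTC, ← integral_Ioc_eq_integral_Ioo,
    ← intervalIntegral.integral_of_le Real.two_pi_pos.le]
  have hI : ∀ q : ℝ, IntervalIntegrable (fun φ => F (q, φ)) volume 0 (2 * Real.pi) := by
    intro q
    have : Continuous fun φ => F (q, φ) :=
      (hfc.comp (by fun_prop : Continuous fun φ : ℝ => (q, φ))).mul
        (continuous_const (y := profile g u t ((p : ℂ) - I * (q : ℂ))))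
    exact this.intervalIntegrable _ _
  rw [intervalIntegral.integral_sub (hI _) (hI _)]
  simp only [hF, intervalIntegral.integral_mul_const, intervalIntegral.integral_ofReal]
  push_cast
  ring_nf

/-- The unsmeared formula: on the spheroid `|α|² = p² + a²`, which cancels the factor `|r̃|²` of the
volume element against `|α / r̃|²`, and at the poles `|r̃| = |α|`. -/
theorem integral_boundaryDensity_eq_localFormula (hy : y ≠ 0) (hu : ‖y‖ < |u|) (hε : 0 < ε)
    (h : Orthonormal ℝ ![e₁, e₂, ‖y‖⁻¹ • y]) (hg : DifferentiableOn ℂ g {τ | τ.im ≠ 0}) (t : ℝ)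
    (f : 𝓓((⊤ : TopologicalSpace.Opens Space), ℝ)) :
    IntegrableOn (shellDensity ‖y‖ (ε * ‖y‖) (layerFlow g y u ε e₁ e₂ t f)) (osRange ‖y‖) ∧
    ∫ v in osRange ‖y‖, boundaryDensity g y e₁ e₂ u t f (ε * ‖y‖) v =
      localFormula g y u ε e₁ e₂ t f := by
  have hy' : 0 < ‖y‖ := norm_pos_iff.2 hy
  have hc : 0 < ε * ‖y‖ := mul_pos hε hy'
  obtain ⟨i1, h1⟩ := integral_boundaryDensity_eq hy hu e₁ e₂ hg t hc f
  rw [h1]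
  simp only [localFormula, shellDelta, poleDelta]
  set c := ε * ‖y‖ with hcdef
  have hn : ∀ q : ℝ, ‖(c : ℂ) - I * (q : ℂ)‖ ^ 2 = c ^ 2 + q ^ 2 := fun q => by
    rw [← normSq_eq_norm_sq, normSq_apply]; simp; ring
  have hlayer : ∀ v ∈ osRange ‖y‖,
      shellDensity ‖y‖ c (layerFlow g y u ε e₁ e₂ t f) v =
      (((c ^ 2 + ‖y‖ ^ 2) / ‖y‖ : ℝ) : ℂ) * (profile g u t ((c : ℂ) - I * (v.1 : ℂ)) *
        dPQ (fun p' q' => f (osPoint y e₁ e₂ p' q' v.2)) c v.1) := fun v hv => by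
    rw [shellDensity, layerFlow, beam_eq, complexDist_osPoint hy h hc (Ioo_subset_Icc_self hv.1),
      norm_div, div_pow, ← hcdef, hn, hn]
    have hcq : (c : ℂ) ^ 2 + (v.1 : ℂ) ^ 2 ≠ 0 := by
      exact_mod_cast (by positivity : c ^ 2 + v.1 ^ 2 ≠ 0)
    push_cast
    field_simp
  have hpole : ∀ q ∈ Icc (-‖y‖) ‖y‖, q ^ 2 = ‖y‖ ^ 2 → ∫ φ in (0 : ℝ)..(2 * Real.pi),
      shellDensity ‖y‖ c (fun p q φ => beam g y u (osPoint y e₁ e₂ p q φ, t) *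
        (f (osPoint y e₁ e₂ p q φ) : ℂ)) (q, φ) =
      (((c ^ 2 + ‖y‖ ^ 2) / ‖y‖ : ℝ) : ℂ) * (profile g u t ((c : ℂ) - I * (q : ℂ)) *
        (∫ φ in (0 : ℝ)..(2 * Real.pi), f (osPoint y e₁ e₂ c q φ) : ℝ)) := fun q hq hqq => by
    rw [← intervalIntegral.integral_ofReal, ← intervalIntegral.integral_const_mul,
      ← intervalIntegral.integral_const_mul]
    refine intervalIntegral.integral_congr fun φ _ => ?_
    simp only [shellDensity]
    rw [beam_eq, complexDist_osPoint hy h hc hq, hn, hqq]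
  constructor
  · exact IntegrableOn.congr_fun (i1.const_mul (((c ^ 2 + ‖y‖ ^ 2) / ‖y‖ : ℝ) : ℂ))
      (fun v hv => (hlayer v hv).symm) (measurableSet_osRange _)
  · rw [hpole (-‖y‖) ⟨le_rfl, by linarith⟩ (neg_sq _), hpole ‖y‖ ⟨by linarith, le_rfl⟩ rfl,
      setIntegral_congr_fun (measurableSet_osRange _) hlayer, integral_const_mul]
    rw [show (c : ℂ) - I * ((-‖y‖ : ℝ) : ℂ) = (c : ℂ) + I * (‖y‖ : ℂ) by push_cast; ring]
    ring

theorem hasFDerivAt_intervalIntegral_of_continuousOn {F : ℝ × ℝ → ℝ → ℝ}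
    {F' : ℝ × ℝ → ℝ → (ℝ × ℝ →L[ℝ] ℝ)} {U : Set (ℝ × ℝ)} (hU : IsOpen U) {x₀ : ℝ × ℝ}
    (hx : x₀ ∈ U) {b : ℝ} (hb : 0 ≤ b) (hF : ∀ v, Continuous (F v))
    (hF' : ContinuousOn (fun w : (ℝ × ℝ) × ℝ => F' w.1 w.2) (U ×ˢ univ))
    (hd : ∀ v ∈ U, ∀ φ, HasFDerivAt (fun v => F v φ) (F' v φ) v) :
    IntervalIntegrable (F' x₀) volume 0 b ∧
      HasFDerivAt (fun v => ∫ φ in (0 : ℝ)..b, F v φ) (∫ φ in (0 : ℝ)..b, F' x₀ φ) x₀ := by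
  obtain ⟨δ, hδ, hball⟩ := Metric.nhds_basis_closedBall.mem_iff.1 (hU.mem_nhds hx)
  obtain ⟨M, hM⟩ := ((isCompact_closedBall x₀ δ).prod
    (isCompact_Icc (a := (0 : ℝ)) (b := b))).exists_bound_of_continuousOn
    (hF'.mono fun w hw => ⟨hball hw.1, trivial⟩)
  have hc : Continuous (F' x₀) := continuousOn_univ.1
    (hF'.comp (by fun_prop : Continuous fun φ : ℝ => (x₀, φ)).continuousOn
      fun φ _ => ⟨hx, trivial⟩)
  refine ⟨hc.intervalIntegrable _ _, ?_⟩
  refine intervalIntegral.hasFDerivAt_integral_of_dominated_of_fderiv_le (𝕜 := ℝ)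
    (bound := fun _ => M) (F := F) (F' := F') (Metric.closedBall_mem_nhds _ hδ)
    (Eventually.of_forall fun v => (hF v).aestronglyMeasurable)
    ((hF x₀).intervalIntegrable _ _) hc.aestronglyMeasurable
    (Eventually.of_forall fun φ hφ v hv => hM (v, φ) ⟨hv, ?_⟩)
    intervalIntegrable_const
    (Eventually.of_forall fun φ _ v hv => hd v (hball hv) φ)
  rw [uIoc_of_le hb] at hφ
  exact Ioc_subset_Icc_self hφ

/-- Differentiation of the azimuthal mean under the integral sign. -/
theorem hasFDerivAt_azMean (hy : y ≠ 0) (e₁ e₂ : Space)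
    (f : 𝓓((⊤ : TopologicalSpace.Opens Space), ℝ)) (p : ℝ) {q : ℝ}
    (hq : q ∈ Ioo (-‖y‖) ‖y‖) :
    IntervalIntegrable (fun φ => fderiv ℝ f (osPoint y e₁ e₂ p q φ) ∘L
      ((ContinuousLinearMap.fst ℝ ℝ ℝ).smulRight (osDirP y e₁ e₂ p q φ) +
        (ContinuousLinearMap.snd ℝ ℝ ℝ).smulRight (osDirQ y e₁ e₂ p q φ)))
      volume 0 (2 * Real.pi) ∧
    HasFDerivAt (fun v : ℝ × ℝ => azMean y e₁ e₂ f v.1 v.2)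
      ((1 / (2 * Real.pi)) • ∫ φ in (0 : ℝ)..(2 * Real.pi),
        fderiv ℝ f (osPoint y e₁ e₂ p q φ) ∘L
          ((ContinuousLinearMap.fst ℝ ℝ ℝ).smulRight (osDirP y e₁ e₂ p q φ) +
          (ContinuousLinearMap.snd ℝ ℝ ℝ).smulRight (osDirQ y e₁ e₂ p q φ))) (p, q) := by
  set Φ' : ℝ × ℝ → ℝ → (ℝ × ℝ →L[ℝ] ℝ) := fun v φ => fderiv ℝ f (osPoint y e₁ e₂ v.1 v.2 φ) ∘L
    ((ContinuousLinearMap.fst ℝ ℝ ℝ).smulRight (osDirP y e₁ e₂ v.1 v.2 φ) +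
      (ContinuousLinearMap.snd ℝ ℝ ℝ).smulRight (osDirQ y e₁ e₂ v.1 v.2 φ)) with hΦ'
  have hcont : ContinuousOn (fun w : (ℝ × ℝ) × ℝ => Φ' w.1 w.2)
      ((univ ×ˢ Ioo (-‖y‖) ‖y‖) ×ˢ univ) := by
    have hP : Continuous fun w : (ℝ × ℝ) × ℝ => osPoint y e₁ e₂ w.1.1 w.1.2 w.2 :=
      (continuous_osPoint y e₁ e₂).comp
        (by fun_prop : Continuous fun w : (ℝ × ℝ) × ℝ => (w.1.1, w.1.2, w.2))
    have hf' : Continuous fun w : (ℝ × ℝ) × ℝ => fderiv ℝ f (osPoint y e₁ e₂ w.1.1 w.1.2 w.2) :=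
      (f.contDiff.continuous_fderiv (by simp)).comp hP
    have hρ : Continuous fun w : (ℝ × ℝ) × ℝ => osRadius ‖y‖ w.1.1 w.1.2 :=
      (continuous_osRadius ‖y‖).comp continuous_fst
    have hr : Continuous fun w : (ℝ × ℝ) × ℝ => radialDir e₁ e₂ w.2 :=
      (continuous_radialDir e₁ e₂).comp continuous_snd
    have hpos : ∀ w : (ℝ × ℝ) × ℝ, w.1.1 ^ 2 + ‖y‖ ^ 2 ≠ 0 := fun w => by
      have := norm_pos_iff.2 hy; positivity
    have hDP : Continuous fun w : (ℝ × ℝ) × ℝ => osDirP y e₁ e₂ w.1.1 w.1.2 w.2 := by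
      unfold osDirP
      fun_prop (disch := assumption)
    have hDQ : ContinuousOn (fun w : (ℝ × ℝ) × ℝ => osDirQ y e₁ e₂ w.1.1 w.1.2 w.2)
        ((univ ×ˢ Ioo (-‖y‖) ‖y‖) ×ˢ univ) := by
      refine ContinuousOn.sub (by fun_prop) (ContinuousOn.smul (ContinuousOn.div (by fun_prop)
        (by fun_prop) fun w hw => (sq_sub_sq_pos hw.1.2).ne') hr.continuousOn)
    refine hf'.continuousOn.clm_comp (ContinuousOn.add ?_ ?_)
    · exact ((ContinuousLinearMap.smulRightL ℝ (ℝ × ℝ) Space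
        (ContinuousLinearMap.fst ℝ ℝ ℝ)).continuous.comp hDP).continuousOn
    · exact (ContinuousLinearMap.smulRightL ℝ (ℝ × ℝ) Space
        (ContinuousLinearMap.snd ℝ ℝ ℝ)).continuous.comp_continuousOn hDQ
  have hfc : ∀ v : ℝ × ℝ, Continuous fun φ : ℝ => f (osPoint y e₁ e₂ v.1 v.2 φ) := fun v =>
    f.continuous.comp ((continuous_osPoint y e₁ e₂).comp
      (by fun_prop : Continuous fun φ : ℝ => (v.1, v.2, φ)))
  obtain ⟨h1, h2⟩ := hasFDerivAt_intervalIntegral_of_continuousOn (isOpen_univ.prod isOpen_Ioo)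
    (⟨trivial, hq⟩ : ((p, q) : ℝ × ℝ) ∈ univ ×ˢ Ioo (-‖y‖) ‖y‖) Real.two_pi_pos.le hfc hcont
    fun v hv φ => hasFDerivAt_comp_osPoint hy e₁ e₂ f v.1 φ hv.2
  exact ⟨h1, h2.const_smul (1 / (2 * Real.pi))⟩

theorem dPQ_azMean (hy : y ≠ 0) (e₁ e₂ : Space)
    (f : 𝓓((⊤ : TopologicalSpace.Opens Space), ℝ)) (p : ℝ) {q : ℝ}
    (hq : q ∈ Ioo (-‖y‖) ‖y‖) :
    dPQ (azMean y e₁ e₂ f) p q = ((1 / (2 * Real.pi) : ℝ) : ℂ) *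
      ∫ φ in Ioo 0 (2 * Real.pi), dPQ (fun p' q' => f (osPoint y e₁ e₂ p' q' φ)) p q := by
  obtain ⟨hi, hd⟩ := hasFDerivAt_azMean hy e₁ e₂ f p hq
  rw [dPQ_eq_of_hasFDerivAt hd]
  have hap : ∀ v : ℝ × ℝ, IntervalIntegrable (fun φ => (fderiv ℝ f (osPoint y e₁ e₂ p q φ) ∘L
      ((ContinuousLinearMap.fst ℝ ℝ ℝ).smulRight (osDirP y e₁ e₂ p q φ) +
        (ContinuousLinearMap.snd ℝ ℝ ℝ).smulRight (osDirQ y e₁ e₂ p q φ))) v)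
      volume 0 (2 * Real.pi) := fun v =>
    ⟨(ContinuousLinearMap.apply ℝ ℝ v).integrable_comp hi.1,
      (ContinuousLinearMap.apply ℝ ℝ v).integrable_comp hi.2⟩
  have hapC : ∀ v : ℝ × ℝ, IntervalIntegrable (fun φ =>
      (((fderiv ℝ f (osPoint y e₁ e₂ p q φ) ∘L
      ((ContinuousLinearMap.fst ℝ ℝ ℝ).smulRight (osDirP y e₁ e₂ p q φ) +
        (ContinuousLinearMap.snd ℝ ℝ ℝ).smulRight (osDirQ y e₁ e₂ p q φ))) v : ℝ) : ℂ))
      volume 0 (2 * Real.pi) := fun v => ⟨(hap v).1.ofReal, (hap v).2.ofReal⟩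
  have h1 : ∀ φ, dPQ (fun p' q' => f (osPoint y e₁ e₂ p' q' φ)) p q = _ := fun φ =>
    dPQ_eq_of_hasFDerivAt (hasFDerivAt_comp_osPoint hy e₁ e₂ f p φ hq)
  simp only [h1]
  rw [← integral_Ioc_eq_integral_Ioo, ← intervalIntegral.integral_of_le Real.two_pi_pos.le,
    intervalIntegral.integral_add (hapC _) ((hapC _).const_mul I),
    intervalIntegral.integral_const_mul, intervalIntegral.integral_ofReal,
    intervalIntegral.integral_ofReal, _root_.smul_apply, _root_.smul_apply,
    ContinuousLinearMap.intervalIntegral_apply hi, ContinuousLinearMap.intervalIntegral_apply hi]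
  simp only [smul_eq_mul]
  push_cast
  ring

theorem intervalIntegrable_dPQ_azMean (hy : y ≠ 0) (e₁ e₂ : Space)
    (f : 𝓓((⊤ : TopologicalSpace.Opens Space), ℝ)) (p : ℝ) :
    IntervalIntegrable (fun q => dPQ (azMean y e₁ e₂ f) p q) volume (-‖y‖) ‖y‖ := by
  have h := integrableOn_dPQ hy e₁ e₂ f p
  rw [IntegrableOn, restrict_osRange] at h
  rw [intervalIntegrable_iff_integrableOn_Ioo_of_le (by linarith [norm_nonneg y])]
  exact IntegrableOn.congr_fun (h.integral_prod_left.const_mul _)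
    (fun q hq => (dPQ_azMean hy e₁ e₂ f p hq).symm) measurableSet_Ioo

/-- The smeared formula: every coefficient depends on `q` only, so the azimuth is integrated out. -/
theorem integral_boundaryDensity_eq_smearedFormula (hy : y ≠ 0) (hu : ‖y‖ < |u|) (hε : 0 < ε)
    (e₁ e₂ : Space) (hg : DifferentiableOn ℂ g {τ | τ.im ≠ 0}) (t : ℝ)
    (f : 𝓓((⊤ : TopologicalSpace.Opens Space), ℝ)) :
    ∫ v in osRange ‖y‖, boundaryDensity g y e₁ e₂ u t f (ε * ‖y‖) v =
      smearedFormula g y u ε e₁ e₂ t f := by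
  have hy' : 0 < ‖y‖ := norm_pos_iff.2 hy
  have hc : 0 < ε * ‖y‖ := mul_pos hε hy'
  obtain ⟨i1, h1⟩ := integral_boundaryDensity_eq hy hu e₁ e₂ hg t hc f
  rw [h1]
  simp only [smearedFormula]
  set c := ε * ‖y‖ with hcdef
  have hπ : (Real.pi : ℂ) ≠ 0 := by exact_mod_cast Real.pi_ne_zero
  have hyC : (‖y‖ : ℂ) ≠ 0 := by exact_mod_cast hy'.ne'
  have hz : ∀ q ∈ Icc (-‖y‖) ‖y‖, (c : ℂ) - I * (q : ℂ) ≠ 0 := fun q hq =>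
    ne_zero_of_mem_halfStrip (sub_I_mul_mem_halfStrip hu hc hq)
  have hconj : conj ((c : ℂ) - I * (‖y‖ : ℂ)) = (c : ℂ) + I * (‖y‖ : ℂ) := by
    simp
  have hα : (c : ℂ) - I * (‖y‖ : ℂ) ≠ 0 := hz ‖y‖ ⟨by linarith, le_rfl⟩
  have hα' : (c : ℂ) + I * (‖y‖ : ℂ) ≠ 0 := by
    rw [← hconj]; exact (map_ne_zero (starRingEnd ℂ)).2 hα
  have hint : ∫ v in osRange ‖y‖, profile g u t ((c : ℂ) - I * (v.1 : ℂ)) *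
      dPQ (fun p' q' => f (osPoint y e₁ e₂ p' q' v.2)) c v.1 =
      ∫ q in (-‖y‖)..‖y‖, 1 / ((c : ℂ) - I * (q : ℂ)) *
        g ((t : ℂ) - I * (u : ℂ) - ((c : ℂ) - I * (q : ℂ))) *
        ((1 / 2) * dPQ (azMean y e₁ e₂ f) c q) := by
    rw [IntegrableOn, restrict_osRange] at i1
    rw [restrict_osRange, integral_prod _ i1, intervalIntegral.integral_of_le (by linarith),
      integral_Ioc_eq_integral_Ioo]
    refine setIntegral_congr_fun measurableSet_Ioo fun q hq => ?_
    simp only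
    rw [integral_const_mul, dPQ_azMean hy e₁ e₂ f c hq, profile]
    have := hz q (Ioo_subset_Icc_self hq)
    push_cast
    field_simp
    ring
  rw [hint, hconj]
  simp only [azMean, profile]
  have hprod : ((c : ℂ) + I * (‖y‖ : ℂ)) * ((c : ℂ) - I * (‖y‖ : ℂ)) =
      (c : ℂ) ^ 2 + (‖y‖ : ℂ) ^ 2 := by
    linear_combination -(‖y‖ : ℂ) ^ 2 * I_sq
  rw [hprod]
  push_cast
  generalize (∫ q in (-‖y‖)..‖y‖, 1 / ((c : ℂ) - I * (q : ℂ)) *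
        g ((t : ℂ) - I * (u : ℂ) - ((c : ℂ) - I * (q : ℂ))) *
        ((1 / 2) * dPQ (azMean y e₁ e₂ f) c q)) = J
  generalize (c : ℂ) - I * (‖y‖ : ℂ) = α at hα ⊢
  generalize (c : ℂ) + I * (‖y‖ : ℂ) = α' at hα' ⊢
  have hI : I ≠ 0 := I_ne_zero
  field_simp
  ring_nf
  simp only [I_sq]
  ring

end

/-! ### Support of the source -/

theorem exists_frame {y : Space} (hy : y ≠ 0) :
    ∃ e₁ e₂ : Space, Orthonormal ℝ ![e₁, e₂, ‖y‖⁻¹ • y] := by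
  have hs : Orthonormal ℝ (({2} : Set (Fin 3)).domRestrict
      (fun _ : Fin 3 => ‖y‖⁻¹ • y)) := by
    refine ⟨fun _ => ?_, fun i j hij => (hij (Subsingleton.elim i j)).elim⟩
    simp [Set.domRestrict, norm_smul, hy]
  obtain ⟨b, hb⟩ := Orthonormal.exists_orthonormalBasis_extension_of_card_eq (by simp) hs
  refine ⟨b 0, b 1, ?_⟩
  have hv : ![b 0, b 1, ‖y‖⁻¹ • y] = b := by
    funext i
    fin_cases i
    · rfl
    · rfl
    · exact (hb 2 rfl).symm
  rw [hv]
  exact b.orthonormal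

theorem isClosed_spheroid (y : Space) (p : ℝ) : IsClosed (spheroid y p) :=
  isClosed_eq (by fun_prop) continuous_const

theorem osPoint_mem_spheroid {y e₁ e₂ : Space} (hy : y ≠ 0)
    (h : Orthonormal ℝ ![e₁, e₂, ‖y‖⁻¹ • y]) {p : ℝ} (hp : 0 < p) {q : ℝ}
    (hq : q ∈ Icc (-‖y‖) ‖y‖) (φ : ℝ) : osPoint y e₁ e₂ p q φ ∈ spheroid y p := by
  have hy' : 0 < ‖y‖ := norm_pos_iff.2 hy
  have : p ^ 2 + ‖y‖ ^ 2 ≠ 0 := by positivity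
  simp only [spheroid, Set.mem_ofPred_eq]
  rw [norm_sq_osPoint hy h p φ hq, inner_osPoint hy h]
  field_simp
  ring

/-- A test function whose support misses the spheroid is not seen by the source: the boundary
density on the spheroid involves only the values and first derivatives of the test function. -/
theorem sourceAt_eq_zero {y : Space} (hy : y ≠ 0) {u : ℝ} (hu : ‖y‖ < |u|) {ε : ℝ} (hε : 0 < ε)
    {g : ℂ → ℂ} (hg : DifferentiableOn ℂ g {τ | τ.im ≠ 0}) (t : ℝ)
    (f : 𝓓((⊤ : TopologicalSpace.Opens Space), ℝ))
    (hf : Disjoint (tsupport f) (spheroid y (ε * ‖y‖))) : sourceAt g y u ε t f = 0 := by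
  obtain ⟨e₁, e₂, h⟩ := exists_frame hy
  rw [sourceAt_eq_integral_boundaryDensity hy hu hε h hg]
  refine setIntegral_eq_zero_of_forall_eq_zero fun v hv => ?_
  have hmem := osPoint_mem_spheroid hy h (mul_pos hε (norm_pos_iff.2 hy))
    (Ioo_subset_Icc_self hv.1) v.2
  have hnot : osPoint y e₁ e₂ (ε * ‖y‖) v.1 v.2 ∉ tsupport f := fun hx =>
    disjoint_left.1 hf hx hmem
  have h0 := image_eq_zero_of_notMem_tsupport hnot
  have h1 : fderiv ℝ f (osPoint y e₁ e₂ (ε * ‖y‖) v.1 v.2) = 0 := by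
    by_contra hne
    exact hnot (support_fderiv_subset ℝ hne)
  simp [boundaryDensity, h0, h1]

theorem tsupport_timeSlice_subset (F : 𝓓((⊤ : TopologicalSpace.Opens Spacetime), ℝ)) (t : ℝ) :
    tsupport (timeSlice F t) ⊆ (fun x => (x, t)) ⁻¹' tsupport F :=
  tsupport_comp_subset_preimage (F : Spacetime → ℝ) (f := fun x : Space => (x, t)) (by fun_prop)

theorem dsupport_shieldedSource_subset {y : Space} (hy : y ≠ 0) {u : ℝ} (hu : ‖y‖ < |u|) {ε : ℝ}
    (hε : 0 < ε) {g : ℂ → ℂ} (hg : DifferentiableOn ℂ g {τ | τ.im ≠ 0}) :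
    Distribution.dsupport (shieldedSource g y u ε) ⊆ worldTube (spheroid y (ε * ‖y‖)) := by
  have hvan : Distribution.IsVanishingOn (shieldedSource g y u ε)
      (worldTube (spheroid y (ε * ‖y‖)))ᶜ := by
    intro F hF
    have h0 : ∀ t, sourceAt g y u ε t (timeSlice F t) = 0 := fun t =>
      sourceAt_eq_zero hy hu hε hg t _ (disjoint_left.2 fun x hx hmem =>
        hF (tsupport_timeSlice_subset F t hx) hmem)
    rw [((isRegularInTime_sourceAt hy hu hε hg).2 F).2]
    simp only [h0, integral_zero]
  exact sInter_subset_of_mem ⟨hvan, (isClosed_spheroid y _).preimage continuous_fst⟩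

end ShieldedSource

end

open ShieldedSource in
theorem theoremT (y : Space) (hy : y ≠ 0) (u : ℝ) (hu : ‖y‖ < |u|) (ε : ℝ) (hε : 0 < ε)
    (g : ℂ → ℂ) (hg : DifferentiableOn ℂ g {τ | τ.im ≠ 0}) :
    LocallyIntegrable (shieldedBeam g y u ε) ∧
    Distribution.dsupport (shieldedSource g y u ε) ⊆ worldTube (spheroid y (ε * ‖y‖)) ∧
    ∃ T : ℝ → 𝓓'((⊤ : TopologicalSpace.Opens Space), ℂ),
      IsRegularInTime (shieldedSource g y u ε) T ∧
      ∀ e₁ e₂ : Space, Orthonormal ℝ ![e₁, e₂, ‖y‖⁻¹ • y] →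
        ∀ (t : ℝ) (f : 𝓓((⊤ : TopologicalSpace.Opens Space), ℝ)),
          ((∀ q ∈ Ioo (-‖y‖) ‖y‖, DifferentiableAt ℝ
              (fun v : ℝ × ℝ => azMean y e₁ e₂ f v.1 v.2) (ε * ‖y‖, q)) ∧
            IntervalIntegrable (fun q => dPQ (azMean y e₁ e₂ f) (ε * ‖y‖) q)
              volume (-‖y‖) ‖y‖ ∧
            T t f = smearedFormula g y u ε e₁ e₂ t f) ∧
          (IntegrableOn
              (shellDensity ‖y‖ (ε * ‖y‖) (layerFlow g y u ε e₁ e₂ t f)) (osRange ‖y‖) ∧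
            T t f = localFormula g y u ε e₁ e₂ t f) := by
  refine ⟨locallyIntegrable_shieldedBeam hy hu hε hg, dsupport_shieldedSource_subset hy hu hε hg,
    sourceAt g y u ε, isRegularInTime_sourceAt hy hu hε hg, fun e₁ e₂ h t f => ?_⟩
  have hT := sourceAt_eq_integral_boundaryDensity hy hu hε h hg t f
  obtain ⟨hi, hlocal⟩ := integral_boundaryDensity_eq_localFormula hy hu hε h hg t f
  exact ⟨⟨fun q hq => (hasFDerivAt_azMean hy e₁ e₂ f _ hq).2.differentiableAt,
      intervalIntegrable_dPQ_azMean hy e₁ e₂ f _,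
      hT.trans (integral_boundaryDensity_eq_smearedFormula hy hu hε e₁ e₂ hg t f)⟩,
    hi, hT.trans hlocal⟩
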